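/- \textbf{Instance.} Let $[m]$ be the nodes of a finite rooted tree in which every node has at most two children. Write $\mathsf{Des}(i)$, $\mathsf{Anc}(i)$ for the descendants and ancestors of $i$, both including $i$, and $\mathsf{Des}^+(i)=\mathsf{Des}(i)\setminus\{i\}$, $\mathsf{Anc}^+(i)=\mathsf{Anc}(i)\setminus\{i\}$. Node $i$ owns $L(i)\in\mathbb{Z}_{\ge 0}$ time slots. Each job $j$ of a finite set $J$ has a node $K(j)$ and a size $p_j\in\mathbb{Z}_{\ge1}$, and has to run in $p_j$ distinct slots owned by nodes of $\mathsf{Des}(K(j))$; at most $g\ge1$ jobs may run in one slot. For $J'\subseteq J$ and a set $S$ of nodes let $J'(S)=\{j\in J':K(j)\in S\}$ and $p(J')=\sum_{j\in J'}p_j$. Let $\mathrm{OPT}_i$ be the smallest number of slots in which the jobs of $J(\mathsf{Des}(i))$ can be scheduled. For a vector $z$ on nodes put $z(S)=\sum_{i\in S}z(i)$. \textbf{LP solution.} Let $x,y\ge0$ satisfy, for all $i\in[m]$, $j\in J$: $\sum_{i'\in\mathsf{Des}(K(j))}y(i',j)\ge p_j$; $\sum_{j'\in J(\mathsf{Anc}(i))}y(i,j')\le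 g\,x(i)$; $x(i)\le L(i)$; $y(i,j)\le x(i)$; $y(i,j)=0$ if $j\notin J(\mathsf{Anc}(i))$; $x(\mathsf{Des}(i))\ge2$ if $\mathrm{OPT}_i\ge2$; and $x(\mathsf{Des}(i))\ge3$ if $\mathrm{OPT}_i\ge3$. Suppose moreover that $x(i_1)=0$ whenever some $i_2\in\mathsf{Des}^+(i_1)$ has $x(i_2)<L(i_2)$ (each node with positive $x$ has all its strict descendants fully open), and that every leaf $i$ has a job $j$ with $K(j)=i$ or satisfies $x(i)\ge1$. \textbf{Rounding.} Let $I$ be the set of nodes $i$ with $x(i)>0$ and $x(i')=0$ for all $i'\in\mathsf{Anc}^+(i)$. Start with $\tilde x(i)=\lfloor x(i)\rfloor$ for $i\in I$ and $\tilde x(i)=x(i)$ for $i\notin I$. Process every node $i\in\bigcup_{k\in I}\mathsf{Anc}(k)$ once, in any order in which no node comes after one of its strict ancestors: while $\tfrac95x(\mathsf{Des}(i))\ge\tilde x(\mathsf{Des}(i))+1$ and some $i'\in\mathsf{Des}(i)$ has $\tilde x(i')<x(i')$, choose any such $i'$ and set $\tilde x(i')\leftarrow\lceil x(i')\rceil$.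 \textbf{Theorem.} For every possible output $\tilde x$ of this procedure: (i) every $J'\subseteq J$ that satisfies $p_j>\tilde x\big(\{i\in\mathsf{Des}(K(j)):|J'(\mathsf{Anc}(i))|\le g\}\big)$ for all $j\in J'$ also satisfies $$\sum_{i\in[m]}\min\{|J'(\mathsf{Anc}(i))|,g\}\,\tilde x(i)\ \ge\ p(J');$$ (ii) consequently $\tilde x$ is feasible: it is integral, and one can open exactly $\tilde x(i)$ of the $L(i)$ slots of every node $i$ so that all jobs can be scheduled in the open slots. -/

import Mathlib

open scoped Classical in
/-- A nested active-time scheduling instance on a rooted binary tree.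
The nodes of the tree form a finite partial order, where `i ≤ a` means that `i` is a descendant of
`a` or `i = a`; the children of `i` are the nodes `c` with `c ⋖ i`, the leaves are the minimal
nodes. Node `i` owns `len i` time slots that lie in no child of `i`. Job `j` sits at node `node j`,
has to run in `size j` different slots of descendants of `node j` (that node included), and at most
`cap` jobs may run in one slot. -/
structure NestedInstance (V J : Type*) [Fintype V] [PartialOrder V] [Fintype J] where
  root : V
  le_root : ∀ i, i ≤ root
  anc_chain : ∀ i a b : V, i ≤ a → i ≤ b → a ≤ b ∨ b ≤ a
  binary : ∀ i : V, (Finset.univ.filter fun c : V => c ⋖ i).card ≤ 2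
  len : V → ℕ
  node : J → V
  size : J → ℕ
  size_pos : ∀ j, 0 < size j
  cap : ℕ
  cap_pos : 0 < cap

open scoped Classical in
/-- The set of descendants of `i`, with `i` itself. -/
noncomputable def Des {V : Type*} [Fintype V] [PartialOrder V] (i : V) : Finset V :=
  Finset.univ.filter fun i' => i' ≤ i

/-- `i` is a topmost node with `x i > 0`. -/
def IsTopmost {V : Type*} [PartialOrder V] (x : V → ℝ) (i : V) : Prop :=
  0 < x i ∧ ∀ a, i < a → x a = 0

namespace NestedInstance

variable {V J : Type*} [Fintype V] [PartialOrder V] [Fintype J] (N : NestedInstance V J)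

/-- The time slots: node `i` owns `len i` of them. -/
abbrev Slot : Type _ := (i : V) × Fin (N.len i)

open scoped Classical in
/-- The jobs of `J'` that sit at nodes of `Anc(i)`, that is, those that may run in node `i`. -/
noncomputable def jobsAnc (J' : Finset J) (i : V) : Finset J :=
  J'.filter fun j => i ≤ N.node j

open scoped Classical in
/-- The jobs that sit at nodes of `Des(i)`. -/
noncomputable def jobsDes (i : V) : Finset J :=
  Finset.univ.filter fun j => N.node j ≤ i

open scoped Classical in
/-- The jobs of `S` can be scheduled using only the slots of `O`: `σ j` is the set of slots in which
job `j` runs. -/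
def Schedulable (S : Finset J) (O : Finset N.Slot) : Prop :=
  ∃ σ : J → Finset N.Slot,
    (∀ j ∈ S, σ j ⊆ O ∧ (σ j).card = N.size j ∧ ∀ s ∈ σ j, s.1 ≤ N.node j) ∧
    ∀ s, (S.filter fun j => s ∈ σ j).card ≤ N.cap

/-- The smallest number of slots in which the jobs sitting at nodes of `Des(i)` can be scheduled
(infinite if they cannot be scheduled at all). -/
noncomputable def OPT (i : V) : ℕ∞ :=
  ⨅ (O : Finset N.Slot) (_ : N.Schedulable (N.jobsDes i) O), (O.card : ℕ∞)

/-- `(x, y)` is a feasible solution of the strengthened linear program. -/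
structure LPFeasible (x : V → ℝ) (y : V → J → ℝ) : Prop where
  x_nonneg : ∀ i, 0 ≤ x i
  y_nonneg : ∀ i j, 0 ≤ y i j
  scheduled : ∀ j, (N.size j : ℝ) ≤ ∑ i ∈ Des (N.node j), y i j
  capacity : ∀ i, ∑ j ∈ N.jobsAnc Finset.univ i, y i j ≤ N.cap * x i
  x_le_len : ∀ i, x i ≤ N.len i
  y_le_x : ∀ i j, y i j ≤ x i
  y_eq_zero : ∀ i j, j ∉ N.jobsAnc Finset.univ i → y i j = 0
  opt_two : ∀ i, 2 ≤ N.OPT i → 2 ≤ ∑ i' ∈ Des i, x i'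
  opt_three : ∀ i, 3 ≤ N.OPT i → 3 ≤ ∑ i' ∈ Des i, x i'

open scoped Classical in
/-- `J'` is irreducible for the slot vector `xt`. -/
def Irreducible (xt : V → ℝ) (J' : Finset J) : Prop :=
  ∀ j ∈ J', ∑ i ∈ (Des (N.node j)).filter (fun i => (N.jobsAnc J' i).card ≤ N.cap), xt i
    < (N.size j : ℝ)

open scoped Classical in
/-- The slot vector `xt` is feasible: it is integral, and one can open exactly `xt i` of the slots
of every node `i` so that all jobs can be scheduled in the open slots. -/
def FeasibleSlots (xt : V → ℝ) : Prop :=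
  ∃ O : Finset N.Slot,
    (∀ i, ((O.filter fun s => s.1 = i).card : ℝ) = xt i) ∧ N.Schedulable Finset.univ O

end NestedInstance

section Rounding

variable {V : Type*} [Fintype V] [PartialOrder V]

open scoped Classical in
/-- The vector with which the rounding algorithm starts. -/
noncomputable def roundInit (x : V → ℝ) (i : V) : ℝ :=
  if IsTopmost x i then (⌊x i⌋ : ℝ) else x i

open scoped Classical in
/-- `RoundAt x i xt xt'`: the while loop of the rounding algorithm at node `i`, entered with the
vector `xt`, may end with the vector `xt'`. -/
inductive RoundAt (x : V → ℝ) (i : V) : (V → ℝ) → (V → ℝ) → Prop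
  | done (xt : V → ℝ) (h : 9 * (∑ k ∈ Des i, x k) / 5 < (∑ k ∈ Des i, xt k) + 1) :
      RoundAt x i xt xt
  | break (xt : V → ℝ) (h : (∑ k ∈ Des i, xt k) + 1 ≤ 9 * (∑ k ∈ Des i, x k) / 5)
      (hno : ¬ ∃ i' ∈ Des i, xt i' < x i') : RoundAt x i xt xt
  | step (xt xt' : V → ℝ) (i' : V)
      (h : (∑ k ∈ Des i, xt k) + 1 ≤ 9 * (∑ k ∈ Des i, x k) / 5)
      (hi' : i' ∈ Des i) (hlt : xt i' < x i')
      (hrest : RoundAt x i (Function.update xt i' (⌈x i'⌉ : ℝ)) xt') : RoundAt x i xt xt'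

/-- The for loop of the rounding algorithm along a list of nodes. -/
inductive RoundAlong (x : V → ℝ) : List V → (V → ℝ) → (V → ℝ) → Prop
  | nil (xt : V → ℝ) : RoundAlong x [] xt xt
  | cons (i : V) (l : List V) (xt xt' xt'' : V → ℝ) (h : RoundAt x i xt xt')
      (hrest : RoundAlong x l xt' xt'') : RoundAlong x (i :: l) xt xt''

/-- `xt` is a possible output of the rounding algorithm on `x`: the nodes that have a topmost
positive node among their descendants (themselves included) are processed in some order, each once,
and never a node after one of its strict ancestors. -/
def IsRounding (x xt : V → ℝ) : Prop :=
  ∃ l : List V, l.Nodup ∧ (∀ i, i ∈ l ↔ ∃ k, IsTopmost x k ∧ k ≤ i) ∧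
    l.Pairwise (fun a b => ¬ b < a) ∧ RoundAlong x l (roundInit x) xt

end Rounding

/-!
The feasibility of the rounded vector `xt` is a cut condition: for every set `J'` of jobs the
supply `∑ i, min |J'(Anc i)| cap * xt i` has to cover the total size of `J'`. By Hall's theorem,
applied to a gadget graph, this is sufficient (`exists_assignment_of_cut`), and a minimal
violating set is irreducible (`sum_size_le`), so irreducible sets are all that matters.

Call a topmost node lowered if it is rounded down. Its subtree has one open slot and fewer than
two units of `x`, and every node `b` above it has used up its budget:
`xt (Des b) + 1 > 9 / 5 * x (Des b)`. Counting the other topmost nodes, which at most double,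
shows that `xt (Des b) - x (Des b)` is at least the number of lowered nodes below `b` whenever `x (Des b) ≥ 3`
(`card_loweredNodes_le`).

The core is the inequality `demand_add_le`: for every node `b`, the supply in `Des b` minus the
demand served there (sizes of jobs at `Des b` and LP fractions of jobs above `b`) is at least
`f * (xt (Des b) - x (Des b) - number of lowered nodes below b)`, where `f = min |J'(Anc⁺ b)| cap`. At
the root it is the cut condition. It is additive over the children of `b`, and since the load
decreases towards the root, the induction step only needs the bracket to be nonnegative, which is
the counting bound. This leaves the nodes with fewer than three units and a lowered node below
them, for which the strengthened constraints of the linear program bound the optimum.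

* With fewer than two units the jobs of `Des b` fit into one slot, which is located at the unique
  leaf.
* With at least two and fewer than three units (`demand_add_le_of_fork`) there are two topmost
  nodes, a lowered node `u` with one open slot and a node `r` with two, and the jobs of `Des b`
  fit into two slots. One distinguishes which of the three slots are saturated. Irreducibility
  limits the jobs sitting above both `u` and `r`: they have size two unless all slots of `r` are
  saturated, and there are none if no slot of `r` is saturated. In the critical case, where the
  slot of `u` and the lower slot of `r` are saturated and the slot of `r` itself is not, the
  integral schedule in two slots has one slot in each branch, and the slot on the side of `u`
  shows that the jobs there, together with those above both nodes, are at most `cap` many.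
-/

/-! ### Runs of the rounding algorithm -/

section Rounding

variable {V : Type*}

/-- The shape of every vector that occurs during the rounding. -/
def IsPartialRounding [PartialOrder V] (x xt : V → ℝ) : Prop :=
  ∀ k, (¬ IsTopmost x k → xt k = x k) ∧
    (IsTopmost x k → xt k = (⌊x k⌋ : ℝ) ∨ xt k = (⌈x k⌉ : ℝ))

theorem isPartialRounding_roundInit [PartialOrder V] (x : V → ℝ) :
    IsPartialRounding x (roundInit x) := by
  intro k
  by_cases hk : IsTopmost x k <;> simp [roundInit, hk]

variable [Fintype V] [PartialOrder V]

theorem mem_Des {i k : V} : k ∈ Des i ↔ k ≤ i := by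
  simp [Des]

theorem self_mem_Des (i : V) : i ∈ Des i := mem_Des.2 le_rfl

theorem RoundAt.le {x xt xt' : V → ℝ} {i : V} (h : RoundAt x i xt xt') : xt ≤ xt' := by
  classical
  induction h with
  | step xt xt' i' _ _ hlt _ ih =>
    refine le_trans (fun k => ?_) ih
    by_cases hk : k = i'
    · subst hk
      simpa using hlt.le.trans (Int.le_ceil _)
    · simp [hk]
  | _ => exact le_rfl

theorem RoundAt.isPartialRounding {x xt xt' : V → ℝ} {i : V} (h : RoundAt x i xt xt')
    (hxt : IsPartialRounding x xt) : IsPartialRounding x xt' := by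
  classical
  induction h with
  | step xt xt' i' _ _ hlt _ ih =>
    refine ih fun k => ?_
    by_cases hk : k = i'
    · subst hk
      refine ⟨fun hn => absurd ((hxt k).1 hn) hlt.ne, fun _ => Or.inr ?_⟩
      simp
    · simpa [hk] using hxt k
  | _ => exact hxt

theorem RoundAt.exit {x xt xt' : V → ℝ} {i : V} (h : RoundAt x i xt xt') :
    9 * (∑ k ∈ Des i, x k) / 5 < (∑ k ∈ Des i, xt' k) + 1 ∨ ∀ k ∈ Des i, x k ≤ xt' k := by
  induction h with
  | done xt h => exact Or.inl h
  | step _ _ _ _ _ _ _ ih => exact ih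
  | _ xt _ hno => exact Or.inr (by simpa using hno)

theorem RoundAlong.le {x xt xt' : V → ℝ} {l : List V} (h : RoundAlong x l xt xt') : xt ≤ xt' := by
  induction h with
  | nil => exact le_rfl
  | cons _ _ _ _ _ h _ ih => exact h.le.trans ih

theorem RoundAlong.isPartialRounding {x xt xt' : V → ℝ} {l : List V}
    (h : RoundAlong x l xt xt') (hxt : IsPartialRounding x xt) : IsPartialRounding x xt' := by
  induction h with
  | nil => exact hxt
  | cons _ _ _ _ _ h _ ih => exact ih (h.isPartialRounding hxt)

/-- The exit condition of the loop at `i` still holds at the end of the whole run, because the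
entries of the vector never decrease. -/
theorem RoundAlong.exit {x xt xt' : V → ℝ} {l : List V} (h : RoundAlong x l xt xt') :
    ∀ i ∈ l, 9 * (∑ k ∈ Des i, x k) / 5 < (∑ k ∈ Des i, xt' k) + 1 ∨
      ∀ k ∈ Des i, x k ≤ xt' k := by
  induction h with
  | nil => simp
  | cons i l xt xt' xt'' h hrest ih =>
    intro a ha
    rcases List.mem_cons.1 ha with rfl | ha
    · rcases h.exit with h1 | h1
      · left
        have := Finset.sum_le_sum fun k (_ : k ∈ Des a) => hrest.le k
        linarith
      · exact Or.inr fun k hk => (h1 k hk).trans (hrest.le k)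
    · exact ih a ha

end Rounding

/-! ### Hall's theorem for simple bipartite multi-assignments -/

open scoped Classical in
/-- Every `j` can be assigned `p j` different slots it is related to, with at most `g` elements
in each slot, as soon as the cut condition holds. This is Hall's marriage theorem for a gadget
graph: on the left the `p j` copies of each `j` and all pairs `(j, s)`, on the right all pairs `(j, s)`
and `g` copies of each `s`. The left pair `(j, s)` is matched to its right twin when `(j, s)` is
not used, and to a copy of `s` when the twin is taken by a copy of `j`. -/
theorem exists_assignment_of_cut {J S : Type*} [Fintype J] [Fintype S] (R : J → S → Prop)
    (p : J → ℕ) (g : ℕ)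
    (hcut : ∀ J' : Finset J, ∑ j ∈ J', p j ≤ ∑ s, min (J'.filter fun j => R j s).card g) :
    ∃ σ : J → Finset S, (∀ j, (σ j).card = p j ∧ ∀ s ∈ σ j, R j s) ∧
      ∀ s, (Finset.univ.filter fun j => s ∈ σ j).card ≤ g := by
  let t : ((j : J) × Fin (p j)) ⊕ (J × S) → Finset ((J × S) ⊕ (S × Fin g)) :=
    Sum.elim (fun a => Finset.univ.filter fun b => ∃ s, R a.1 s ∧ b = Sum.inl (a.1, s))
      (fun e => Finset.univ.filter fun b => b = Sum.inl e ∨ ∃ k, b = Sum.inr (e.2, k))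
  have hall : ∀ X : Finset (((j : J) × Fin (p j)) ⊕ (J × S)), X.card ≤ (X.biUnion t).card := by
    intro X
    set P := X.toLeft with hP
    set Q := X.toRight with hQ
    have hX : X.card = P.card + Q.card := (Finset.card_toLeft_add_card_toRight (u := X)).symm
    set J' := P.image Sigma.fst with hJ'
    have hPcard : P.card ≤ ∑ j ∈ J', p j := by
      have : P ⊆ J'.sigma fun j => (Finset.univ : Finset (Fin (p j))) := by
        intro a ha
        simp only [Finset.mem_sigma, Finset.mem_univ, and_true]
        exact Finset.mem_image_of_mem _ ha
      simpa using Finset.card_le_card this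
    -- the pairs and the slots adjacent to `X`
    set E : Finset (J × S) := Finset.univ.filter fun e => e.1 ∈ J' ∧ R e.1 e.2 with hE
    set T : Finset S := Q.image Prod.snd with hT
    have hsub : (Q ∪ E).disjSum (T ×ˢ (Finset.univ : Finset (Fin g))) ⊆ X.biUnion t := by
      intro b hb
      rw [Finset.mem_biUnion]
      rcases b with e | ⟨s, k⟩
      · rw [Finset.inl_mem_disjSum, Finset.mem_union] at hb
        rcases hb with he | he
        · exact ⟨Sum.inr e, by simpa [hQ] using he, by simp [t]⟩
        · simp only [hE, Finset.mem_filter, Finset.mem_univ, true_and, hJ', Finset.mem_image] at he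
          obtain ⟨⟨a, ha, hae⟩, hR⟩ := he
          refine ⟨Sum.inl a, by simpa [hP] using ha, ?_⟩
          simp only [t, Sum.elim_inl, Finset.mem_filter, Finset.mem_univ, true_and]
          exact ⟨e.2, hae ▸ hR, by rw [hae]⟩
      · rw [Finset.inr_mem_disjSum, Finset.mem_product] at hb
        obtain ⟨e, he, hes⟩ := Finset.mem_image.1 hb.1
        refine ⟨Sum.inr e, by simpa [hQ] using he, ?_⟩
        simp only [t, Sum.elim_inr, Finset.mem_filter, Finset.mem_univ, true_and]
        exact Or.inr ⟨k, by simp at hes; simp [hes]⟩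
    have hcard := Finset.card_le_card hsub
    rw [Finset.card_disjSum, Finset.card_product, Finset.card_univ, Fintype.card_fin] at hcard
    have hQE : (Q ∪ E).card = Q.card + (E \ Q).card := by
      rw [← Finset.union_sdiff_self_eq_union,
        Finset.card_union_of_disjoint Finset.disjoint_sdiff]
    have hcount : ∑ s, min (J'.filter fun j => R j s).card g ≤ (E \ Q).card + T.card * g := by
      have h1 : ((E \ Q).filter fun e => e.2 ∉ T).card =
          ∑ s ∈ Finset.univ.filter (fun s => s ∉ T), (J'.filter fun j => R j s).card := by
        rw [Finset.card_eq_sum_card_fiberwise (f := Prod.snd)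
          (t := Finset.univ.filter (fun s => s ∉ T))]
        · refine Finset.sum_congr rfl fun s hs => ?_
          simp only [Finset.mem_filter, Finset.mem_univ, true_and] at hs
          refine Finset.card_bij' (fun e _ => e.1) (fun j _ => (j, s)) ?_ ?_ ?_ ?_
          · intro e he
            simp only [Finset.mem_filter, Finset.mem_sdiff, hE, Finset.mem_univ, true_and] at he ⊢
            obtain ⟨⟨⟨he1, -⟩, -⟩, rfl⟩ := he
            exact he1
          · intro j hj
            simp only [Finset.mem_filter, Finset.mem_sdiff, hE, Finset.mem_univ, true_and] at hj ⊢
            refine ⟨⟨⟨hj, fun hq => hs ?_⟩, hs⟩, trivial⟩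
            exact Finset.mem_image_of_mem Prod.snd hq
          · rintro ⟨j, s'⟩ he
            simp only [Finset.mem_filter] at he
            simp [he.2]
          · intro j _
            rfl
        · intro e he
          simp only [Finset.coe_filter, Set.mem_ofPred_eq, Finset.mem_univ, true_and] at he ⊢
          exact he.2
      rw [← Finset.sum_filter_add_sum_filter_not Finset.univ (fun s => s ∉ T)]
      refine add_le_add ?_ ?_
      · refine le_trans (Finset.sum_le_sum fun s _ => min_le_left _ _) ?_
        rw [← h1]
        exact Finset.card_le_card (Finset.filter_subset _ _)
      · refine le_trans (Finset.sum_le_sum fun s _ => min_le_right _ _) ?_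
        rw [Finset.sum_const, smul_eq_mul]
        refine Nat.mul_le_mul_right _ (Finset.card_le_card fun s hs => ?_)
        simpa using hs
    have := hcut J'
    omega
  obtain ⟨m, hinj, hm⟩ := (Finset.all_card_le_biUnion_card_iff_exists_injective t).1 hall
  have hjob : ∀ a : (j : J) × Fin (p j), ∃ s, R a.1 s ∧ m (Sum.inl a) = Sum.inl (a.1, s) := by
    intro a
    simpa [t] using hm (Sum.inl a)
  have hpair : ∀ e : J × S, m (Sum.inr e) = Sum.inl e ∨ ∃ k, m (Sum.inr e) = Sum.inr (e.2, k) := by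
    intro e
    simpa [t] using hm (Sum.inr e)
  choose c hcR hc using hjob
  refine ⟨fun j => Finset.univ.image fun k => c ⟨j, k⟩, fun j => ⟨?_, ?_⟩, fun s => ?_⟩
  · rw [Finset.card_image_of_injective, Finset.card_univ, Fintype.card_fin]
    intro k k' hk
    have : m (Sum.inl ⟨j, k⟩) = m (Sum.inl ⟨j, k'⟩) := by
      rw [hc, hc]
      simp only at hk ⊢
      rw [hk]
    simpa using hinj this
  · intro s hs
    obtain ⟨k, -, rfl⟩ := Finset.mem_image.1 hs
    exact hcR ⟨j, k⟩
  · have hslot : ∀ j ∈ Finset.univ.filter (fun j => s ∈ Finset.univ.image fun k => c ⟨j, k⟩),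
        ∃ k : Fin g, m (Sum.inr (j, s)) = Sum.inr (s, k) := by
      intro j hj
      obtain ⟨k, -, hk⟩ := Finset.mem_image.1 (Finset.mem_filter.1 hj).2
      refine (hpair (j, s)).resolve_left fun h => ?_
      have : m (Sum.inr (j, s)) = m (Sum.inl ⟨j, k⟩) := by
        rw [h, hc]
        simp only at hk ⊢
        rw [hk]
      exact Sum.inr_ne_inl (hinj this)
    have hcard := Finset.card_le_card_of_injOn (fun j => m (Sum.inr (j, s)))
      (t := (Finset.univ : Finset (Fin g)).image fun k => Sum.inr (s, k)) (s := Finset.univ.filter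
        (fun j => s ∈ Finset.univ.image fun k => c ⟨j, k⟩)) ?_ ?_
    · exact hcard.trans (Finset.card_image_le.trans (by simp))
    · intro j hj
      obtain ⟨k, hk⟩ := hslot j hj
      simp [hk]
    · intro j _ j' _ hjj
      simpa using hinj hjj

/-! ### Rounded solutions -/

namespace NestedInstance

variable {V J : Type*} [Fintype V] [PartialOrder V] [Fintype J]

/-- What the argument uses of a rounded solution: `x` is a transformed solution of the linear
program in which every leaf carries at least one unit, and `xt` agrees with `x` except at
topmost nodes, where `x` is rounded down or up. It is rounded down at `u` only if no further unit
fits into the budget of any node above `u`. -/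
structure IsRounded (N : NestedInstance V J) (x : V → ℝ) (y : V → J → ℝ) (xt : V → ℝ) :
    Prop where
  lp : N.LPFeasible x y
  transformed : ∀ i₁ i₂ : V, i₂ < i₁ → x i₂ < N.len i₂ → x i₁ = 0
  one_le_leaf : ∀ i, IsMin i → 1 ≤ x i
  isPartialRounding : IsPartialRounding x xt
  budget : ∀ u b, xt u < x u → u ≤ b →
    9 * (∑ k ∈ Des b, x k) / 5 < (∑ k ∈ Des b, xt k) + 1

/-- A job at a leaf can only run there, and in one unit of time it runs at most once. -/
theorem LPFeasible.one_le_leaf {N : NestedInstance V J} {x : V → ℝ} {y : V → J → ℝ}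
    (hLP : N.LPFeasible x y) {i : V} (hi : IsMin i) {j : J} (hj : N.node j = i) : 1 ≤ x i := by
  have h := hLP.scheduled j
  have hDes : Des (N.node j) = {i} := by
    ext k
    rw [mem_Des, hj, Finset.mem_singleton]
    exact ⟨fun hk => le_antisymm hk (hi hk), fun hk => hk.le⟩
  rw [hDes, Finset.sum_singleton] at h
  have h1 : (1 : ℝ) ≤ N.size j := by exact_mod_cast N.size_pos j
  linarith [hLP.y_le_x i j]

theorem LPFeasible.isRounded {N : NestedInstance V J} {x : V → ℝ} {y : V → J → ℝ}
    (hLP : N.LPFeasible x y)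
    (hTransformed : ∀ i₁ i₂ : V, i₂ < i₁ → x i₂ < N.len i₂ → x i₁ = 0)
    (hLeaf : ∀ i : V, IsMin i → (∃ j, N.node j = i) ∨ 1 ≤ x i)
    {xt : V → ℝ} (hRound : IsRounding x xt) : N.IsRounded x y xt := by
  obtain ⟨l, -, hl, -, hrun⟩ := hRound
  have hpart := hrun.isPartialRounding (isPartialRounding_roundInit x)
  refine ⟨hLP, hTransformed, fun i hi => ?_, hpart, fun u b hu hub => ?_⟩
  · rcases hLeaf i hi with ⟨j, hj⟩ | h
    · exact hLP.one_le_leaf hi hj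
    · exact h
  · have htop : IsTopmost x u := by
      by_contra hn
      exact hu.ne ((hpart u).1 hn)
    rcases hrun.exit b ((hl b).2 ⟨u, htop, hub⟩) with h | h
    · exact h
    · exact absurd hu (h u (mem_Des.2 hub)).not_gt

namespace IsRounded

variable {N : NestedInstance V J} {x : V → ℝ} {y : V → J → ℝ} {xt : V → ℝ}

theorem eq_of_not_isTopmost (h : N.IsRounded x y xt) {k : V} (hk : ¬ IsTopmost x k) :
    xt k = x k :=
  (h.isPartialRounding k).1 hk

theorem isTopmost_of_lt (h : N.IsRounded x y xt) {u : V} (hu : xt u < x u) : IsTopmost x u := by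
  by_contra hn
  exact hu.ne (h.eq_of_not_isTopmost hn)

theorem eq_zero (h : N.IsRounded x y xt) {k : V} (hk : x k = 0) : xt k = 0 := by
  rw [h.eq_of_not_isTopmost (fun ht => ht.1.ne' hk), hk]

theorem nonneg (h : N.IsRounded x y xt) (k : V) : 0 ≤ xt k := by
  have hx := h.lp.x_nonneg k
  by_cases hk : IsTopmost x k
  · rcases (h.isPartialRounding k).2 hk with e | e <;> rw [e]
    · exact_mod_cast Int.floor_nonneg.2 hx
    · exact_mod_cast Int.ceil_nonneg hx
  · rwa [h.eq_of_not_isTopmost hk]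

theorem one_le_of_one_le (h : N.IsRounded x y xt) {k : V} (hx : 1 ≤ x k) : 1 ≤ xt k := by
  by_cases hk : IsTopmost x k
  · have hf : (1 : ℤ) ≤ ⌊x k⌋ := Int.le_floor.2 (by exact_mod_cast hx)
    rcases (h.isPartialRounding k).2 hk with e | e <;> rw [e]
    · exact_mod_cast hf
    · exact hx.trans (Int.le_ceil _)
  · rwa [h.eq_of_not_isTopmost hk]

theorem eq_len_of_lt (h : N.IsRounded x y xt) {i k : V} (hi : 0 < x i) (hk : k < i) :
    x k = N.len k := by
  by_contra hne
  exact hi.ne' (h.transformed i k hk (lt_of_le_of_ne (h.lp.x_le_len k) hne))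

/-- A rounded solution is integral and respects the number of slots of each node. -/
theorem exists_nat (h : N.IsRounded x y xt) (k : V) : ∃ m : ℕ, xt k = m ∧ m ≤ N.len k := by
  have hx := h.lp.x_nonneg k
  by_cases hk : IsTopmost x k
  · have hc : ⌈x k⌉ ≤ (N.len k : ℤ) := Int.ceil_le.2 (by exact_mod_cast h.lp.x_le_len k)
    have hfc : ⌊x k⌋ ≤ ⌈x k⌉ := Int.floor_le_ceil _
    have h0 : 0 ≤ ⌊x k⌋ := Int.floor_nonneg.2 hx
    rcases (h.isPartialRounding k).2 hk with e | e
    · exact ⟨⌊x k⌋.toNat, by rw [e]; exact_mod_cast (Int.toNat_of_nonneg h0).symm, by omega⟩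
    · exact ⟨⌈x k⌉.toNat, by
        rw [e]; exact_mod_cast (Int.toNat_of_nonneg (h0.trans hfc)).symm, by omega⟩
  · rw [h.eq_of_not_isTopmost hk]
    rcases hx.eq_or_lt with h0 | hpos
    · exact ⟨0, by simp [← h0], Nat.zero_le _⟩
    · have : ∃ a, k < a ∧ x a ≠ 0 := by
        by_contra hno
        push Not at hno
        exact hk ⟨hpos, hno⟩
      obtain ⟨a, hka, ha⟩ := this
      exact ⟨N.len k, h.eq_len_of_lt (lt_of_le_of_ne (h.lp.x_nonneg a) ha.symm) hka, le_rfl⟩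

end IsRounded

theorem isTopmost_eq_of_le {V : Type*} [PartialOrder V] {x : V → ℝ} {i i' : V}
    (hi : IsTopmost x i) (hi' : IsTopmost x i') (hle : i ≤ i') : i = i' := by
  by_contra hne
  exact hi'.1.ne' (hi.2 i' (lt_of_le_of_ne hle hne))

theorem exists_isMin_le (i : V) : ∃ l, l ≤ i ∧ IsMin l := by
  obtain ⟨l, hl, hmin⟩ := (Set.toFinite {k | k ≤ i}).exists_minimal ⟨i, le_rfl⟩
  exact ⟨l, hl, fun k hk => hmin (hk.trans hl) hk⟩

open scoped Classical in
theorem sum_Des_eq_add (g : V → ℝ) (i : V) :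
    ∑ k ∈ Des i, g k = g i + ∑ k ∈ Des i with k ≠ i, g k := by
  rw [Finset.filter_ne', Finset.add_sum_erase _ _ (self_mem_Des i)]

namespace IsRounded

variable {N : NestedInstance V J} {x : V → ℝ} {y : V → J → ℝ} {xt : V → ℝ}

theorem exists_isTopmost_comparable (h : N.IsRounded x y xt) (v : V) :
    ∃ i, IsTopmost x i ∧ (v ≤ i ∨ i ≤ v) := by
  obtain ⟨l, hlv, hl⟩ := exists_isMin_le v
  have hxl := h.one_le_leaf l hl
  obtain ⟨i, ⟨hli, hi⟩, hmax⟩ := (Set.toFinite {a | l ≤ a ∧ 0 < x a}).exists_maximal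
    ⟨l, le_rfl, by linarith⟩
  refine ⟨i, ⟨hi, fun a hia => ?_⟩, N.anc_chain l v i hlv hli⟩
  by_contra hne
  exact hia.not_ge (hmax ⟨hli.trans hia.le, lt_of_le_of_ne (h.lp.x_nonneg a) (Ne.symm hne)⟩ hia.le)

theorem one_le_sum_Des (h : N.IsRounded x y xt) (b : V) : 1 ≤ ∑ k ∈ Des b, x k := by
  obtain ⟨l, hlb, hl⟩ := exists_isMin_le b
  exact (h.one_le_leaf l hl).trans
    (Finset.single_le_sum (fun k _ => h.lp.x_nonneg k) (mem_Des.2 hlb))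

open scoped Classical in
/-- Strictly below a topmost node all slots are open, so that there the rounding changes nothing and
the number of units is an integer, positive unless the node is a leaf. -/
theorem exists_sum_strict (h : N.IsRounded x y xt) {i : V} (hi : IsTopmost x i) :
    ∃ M : ℕ, (∑ k ∈ Des i with k ≠ i, x k) = M ∧ (∑ k ∈ Des i with k ≠ i, xt k) = M ∧
      (¬ IsMin i → 1 ≤ M) := by
  have hlt : ∀ k ∈ (Des i).filter (· ≠ i), k < i := fun k hk =>
    lt_of_le_of_ne (mem_Des.1 (Finset.mem_filter.1 hk).1) (Finset.mem_filter.1 hk).2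
  have hx : ∀ k ∈ (Des i).filter (· ≠ i), x k = N.len k := fun k hk =>
    h.eq_len_of_lt hi.1 (hlt k hk)
  have hM : (∑ k ∈ Des i with k ≠ i, x k) = (∑ k ∈ Des i with k ≠ i, N.len k : ℕ) := by
    rw [Finset.sum_congr rfl hx]
    push_cast
    rfl
  refine ⟨_, hM, ?_, fun hmin => ?_⟩
  · rw [← hM]
    refine Finset.sum_congr rfl fun k hk => h.eq_of_not_isTopmost fun hk' => ?_
    exact (hlt k hk).ne (isTopmost_eq_of_le hk' hi (hlt k hk).le)
  · obtain ⟨l, hli, hl⟩ := exists_isMin_le i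
    have hne : l ≠ i := fun e => hmin (e ▸ hl)
    have h1 := (h.one_le_leaf l hl).trans (Finset.single_le_sum (fun k _ => h.lp.x_nonneg k)
      (Finset.mem_filter (p := (· ≠ i)).2 ⟨mem_Des.2 hli, hne⟩))
    rw [hM] at h1
    exact_mod_cast h1

/-- The subtree of a topmost node that is rounded down has one open slot after the rounding and
less than two units before it. -/
theorem sum_of_lt (h : N.IsRounded x y xt) {u : V} (hu : xt u < x u) :
    ∑ k ∈ Des u, xt k = 1 ∧ ∑ k ∈ Des u, x k < 2 := by
  have ht := h.isTopmost_of_lt hu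
  obtain ⟨M, hM, hMt, -⟩ := h.exists_sum_strict ht
  have hb := h.budget u u hu le_rfl
  have h1 := h.one_le_sum_Des u
  have hx := sum_Des_eq_add x u
  have hxt := sum_Des_eq_add xt u
  rw [hM] at hx
  rw [hMt] at hxt
  rcases (h.isPartialRounding u).2 ht with e | e
  · have hf1 := Int.floor_le (x u)
    have hf2 := Int.lt_floor_add_one (x u)
    rw [← e] at hf1 hf2
    have hlt : (∑ k ∈ Des u, xt k) < 2 := by linarith
    have hgt : 0 < ∑ k ∈ Des u, xt k := by linarith
    rw [hxt, e] at hlt hgt ⊢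
    have h2 : (⌊x u⌋ + M : ℤ) < 2 := by exact_mod_cast hlt
    have h3 : (0 : ℤ) < ⌊x u⌋ + M := by exact_mod_cast hgt
    have h4 : (⌊x u⌋ + M : ℤ) = 1 := by omega
    have h5 : (⌊x u⌋ + M : ℝ) = 1 := by exact_mod_cast h4
    exact ⟨h5, by rw [e] at hf2; linarith⟩
  · exact absurd hu (by rw [e]; exact (Int.le_ceil _).not_gt)

/-- In the subtree of a topmost node the rounding gains less than `1`. -/
theorem sum_xt_lt (h : N.IsRounded x y xt) {i : V} (hi : IsTopmost x i) :
    ∑ k ∈ Des i, xt k < ∑ k ∈ Des i, x k + 1 := by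
  obtain ⟨M, hM, hMt, -⟩ := h.exists_sum_strict hi
  rw [sum_Des_eq_add x, sum_Des_eq_add xt, hM, hMt]
  have h1 := Int.floor_le (x i)
  have h2 := Int.ceil_lt_add_one (x i)
  rcases (h.isPartialRounding i).2 hi with e | e <;> rw [e] <;> linarith

theorem exists_nat_sum_xt (h : N.IsRounded x y xt) {i : V} :
    ∃ m : ℕ, ∑ k ∈ Des i, xt k = m := by
  choose m hm _ using h.exists_nat
  exact ⟨∑ k ∈ Des i, m k, by push_cast; exact Finset.sum_congr rfl fun k _ => hm k⟩

/-- A node with less than two units in its subtree has a single leaf below it. -/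
theorem exists_leaf_le (h : N.IsRounded x y xt) {b : V} (hb : ∑ k ∈ Des b, x k < 2) :
    ∃ l, IsMin l ∧ ∀ k ≤ b, l ≤ k := by
  classical
  obtain ⟨l, hlb, hl⟩ := exists_isMin_le b
  refine ⟨l, hl, fun k hk => ?_⟩
  obtain ⟨l', hlk, hl'⟩ := exists_isMin_le k
  by_cases hne : l = l'
  · exact hne ▸ hlk
  · have h1 : ∑ k ∈ ({l, l'} : Finset V), x k ≤ ∑ k ∈ Des b, x k := by
      refine Finset.sum_le_sum_of_subset_of_nonneg (fun a ha => ?_) fun k _ _ => h.lp.x_nonneg k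
      rcases Finset.mem_insert.1 ha with rfl | ha
      · exact mem_Des.2 hlb
      · rw [Finset.mem_singleton.1 ha]
        exact mem_Des.2 (hlk.trans hk)
    rw [Finset.sum_pair hne] at h1
    linarith [h.one_le_leaf l hl, h.one_le_leaf l' hl']

open scoped Classical in
/-- The subtree sum of a vector that vanishes where `x` does splits along the topmost nodes. -/
theorem sum_Des_eq_sum_topmost (h : N.IsRounded x y xt) {g : V → ℝ}
    (hg : ∀ k, x k = 0 → g k = 0) {i b : V} (hi : IsTopmost x i) (hib : i ≤ b) :
    ∑ k ∈ Des b, g k = ∑ a ∈ Des b with IsTopmost x a, ∑ k ∈ Des a, g k := by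
  rw [← Finset.sum_biUnion]
  · refine (Finset.sum_subset (fun k hk => ?_) fun k hk hk' => hg k ?_).symm
    · obtain ⟨a, ha, hka⟩ := Finset.mem_biUnion.1 hk
      exact mem_Des.2 ((mem_Des.1 hka).trans (mem_Des.1 (Finset.mem_filter.1 ha).1))
    · by_contra hne
      have hkb := mem_Des.1 hk
      obtain ⟨a, ha, hka⟩ : ∃ a, IsTopmost x a ∧ k ≤ a := by
        obtain ⟨a, ha, hka | hak⟩ := h.exists_isTopmost_comparable k
        · exact ⟨a, ha, hka⟩
        · rcases hak.eq_or_lt with rfl | hlt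
          · exact ⟨a, ha, le_rfl⟩
          · exact absurd (ha.2 k hlt) hne
      refine hk' (Finset.mem_biUnion.2 ⟨a, Finset.mem_filter.2 ⟨mem_Des.2 ?_, ha⟩, mem_Des.2 hka⟩)
      rcases N.anc_chain k a b hka hkb with h1 | h1
      · exact h1
      · exact (isTopmost_eq_of_le hi ha (hib.trans h1)) ▸ hib
  · intro a ha a' ha' hne
    refine Finset.disjoint_left.2 fun k hk hk' => hne ?_
    have h1 := (Finset.mem_filter.1 ha).2
    have h2 := (Finset.mem_filter.1 ha').2
    rcases N.anc_chain k a a' (mem_Des.1 hk) (mem_Des.1 hk') with h3 | h3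
    · exact isTopmost_eq_of_le h1 h2 h3
    · exact (isTopmost_eq_of_le h2 h1 h3).symm

open scoped Classical in
/-- The nodes below `b` that are rounded down. -/
noncomputable def loweredNodes (x xt : V → ℝ) (b : V) : Finset V :=
  (Des b).filter fun u => xt u < x u

theorem mem_loweredNodes {b u : V} : u ∈ loweredNodes x xt b ↔ u ≤ b ∧ xt u < x u := by
  rw [loweredNodes, Finset.mem_filter, mem_Des]

/-- Where the subtree of `b` holds at least three units, the rounding gains at least one unit
for every node that is rounded down. -/
theorem card_loweredNodes_le (h : N.IsRounded x y xt) {b : V} (hb : 3 ≤ ∑ k ∈ Des b, x k)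
    (hne : (loweredNodes x xt b).Nonempty) :
    ((loweredNodes x xt b).card : ℝ) ≤ ∑ k ∈ Des b, xt k - ∑ k ∈ Des b, x k := by
  classical
  obtain ⟨u, hu⟩ := hne
  have hub := (mem_loweredNodes.1 hu).1
  have hux := (mem_loweredNodes.1 hu).2
  have ht := h.isTopmost_of_lt hux
  have hbud := h.budget u b hux hub
  have hsub : loweredNodes x xt b ⊆ (Des b).filter (IsTopmost x) := fun a ha =>
    Finset.mem_filter.2 ⟨mem_Des.2 (mem_loweredNodes.1 ha).1,
      h.isTopmost_of_lt (mem_loweredNodes.1 ha).2⟩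
  have hx := h.sum_Des_eq_sum_topmost (g := x) (fun _ h => h) ht hub
  have hxt := h.sum_Des_eq_sum_topmost (g := xt) (fun _ => h.eq_zero) ht hub
  rw [← Finset.sum_sdiff hsub] at hx hxt
  have h1 : ∑ a ∈ loweredNodes x xt b, ∑ k ∈ Des a, xt k = (loweredNodes x xt b).card := by
    rw [Finset.sum_congr rfl fun a ha => (h.sum_of_lt (mem_loweredNodes.1 ha).2).1]
    simp
  have h2 : ((loweredNodes x xt b).card : ℝ) ≤ ∑ a ∈ loweredNodes x xt b, ∑ k ∈ Des a, x k := by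
    have := Finset.sum_le_sum fun a (_ : a ∈ loweredNodes x xt b) => h.one_le_sum_Des a
    simpa using this
  have h3 : ∑ a ∈ (Des b).filter (IsTopmost x) \ loweredNodes x xt b, ∑ k ∈ Des a, xt k ≤
      2 * ∑ a ∈ (Des b).filter (IsTopmost x) \ loweredNodes x xt b, ∑ k ∈ Des a, x k := by
    rw [Finset.mul_sum]
    refine Finset.sum_le_sum fun a ha => ?_
    have := h.sum_xt_lt (Finset.mem_filter.1 (Finset.mem_sdiff.1 ha).1).2
    linarith [h.one_le_sum_Des a]
  -- With `p` lowered nodes and `W` units below the other topmost nodes, the budget gives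
  -- `p + 2 W + 1 > 9 / 5 * (p + W)`, so that `W > 4 p - 5`, and a gain above
  -- `4 / 5 * (p + W) - 1 > 4 p - 5`, which is at least `p` as soon as `2 ≤ p`. For `p = 1` the gain
  -- exceeds `4 / 5 * 3 - 1`.
  have hpos : 1 ≤ (loweredNodes x xt b).card := Finset.card_pos.2 ⟨u, hu⟩
  rcases hpos.eq_or_lt with hone | htwo
  · rw [← hone]
    push_cast
    linarith
  · have h4 : (2 : ℝ) ≤ (loweredNodes x xt b).card := by exact_mod_cast htwo
    linarith

theorem loweredNodes_eq_singleton (h : N.IsRounded x y xt) {u b : V} (hu : xt u < x u)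
    (hub : u ≤ b) (huniq : ∀ i ≤ b, IsTopmost x i → xt i < x i → i = u) :
    loweredNodes x xt b = {u} := by
  classical
  ext a
  rw [mem_loweredNodes, Finset.mem_singleton]
  constructor
  · rintro ⟨h1, h2⟩
    exact huniq a h1 (h.isTopmost_of_lt h2) h2
  · rintro rfl
    exact ⟨hub, hu⟩

end IsRounded

end NestedInstance

/-! ### Subtrees with fewer than three units -/

namespace NestedInstance

variable {V J : Type*} [Fintype V] [PartialOrder V] [Fintype J]

namespace IsRounded

variable {N : NestedInstance V J} {x : V → ℝ} {y : V → J → ℝ} {xt : V → ℝ}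

theorem sum_Des_eq_of_unique (h : N.IsRounded x y xt) {g : V → ℝ}
    (hg : ∀ k, x k = 0 → g k = 0) {u b : V} (hu : IsTopmost x u) (hub : u ≤ b)
    (huniq : ∀ i ≤ b, IsTopmost x i → i = u) : ∑ k ∈ Des b, g k = ∑ k ∈ Des u, g k := by
  classical
  rw [h.sum_Des_eq_sum_topmost hg hu hub]
  have : (Des b).filter (IsTopmost x) = {u} := by
    ext a
    rw [Finset.mem_filter, Finset.mem_singleton, mem_Des]
    exact ⟨fun ha => huniq a ha.1 ha.2, fun ha => ha ▸ ⟨hub, hu⟩⟩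
  rw [this, Finset.sum_singleton]

theorem unique_of_sum_lt_two (h : N.IsRounded x y xt) {u b : V} (hu : IsTopmost x u)
    (hub : u ≤ b) (hb : ∑ k ∈ Des b, x k < 2) : ∀ i ≤ b, IsTopmost x i → i = u := by
  classical
  intro i hib hi
  by_contra hne
  have hx := h.sum_Des_eq_sum_topmost (g := x) (fun _ h => h) hu hub
  have hsub : ({u, i} : Finset V) ⊆ (Des b).filter (IsTopmost x) := by
    intro a ha
    rcases Finset.mem_insert.1 ha with rfl | ha
    · exact Finset.mem_filter.2 ⟨mem_Des.2 hub, hu⟩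
    · rw [Finset.mem_singleton.1 ha]
      exact Finset.mem_filter.2 ⟨mem_Des.2 hib, hi⟩
  have := Finset.sum_le_sum_of_subset_of_nonneg (f := fun a => ∑ k ∈ Des a, x k) hsub
    fun a _ _ => zero_le_one.trans (h.one_le_sum_Des a)
  rw [Finset.sum_pair (Ne.symm hne)] at this
  linarith [h.one_le_sum_Des u, h.one_le_sum_Des i]

/-- The two branches of a subtree `Des b` with exactly two topmost nodes `u` and `r`: every node of
`Des b` lies in the left branch `Des cu`, in the right branch `Des cr`, or above both `u` and
`r`. -/
structure IsFork (x : V → ℝ) (b u r cu cr : V) : Prop where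
  topmost_left : IsTopmost x u
  topmost_right : IsTopmost x r
  left_le : u ≤ cu
  right_le : r ≤ cr
  le_left : cu ≤ b
  le_right : cr ≤ b
  not_right_le : ¬ r ≤ cu
  not_left_le : ¬ u ≤ cr
  cover : ∀ k ≤ b, k ≤ cu ∨ k ≤ cr ∨ (u ≤ k ∧ r ≤ k)
  unique : ∀ i ≤ b, IsTopmost x i → i = u ∨ i = r

/-- A node `u` has a highest ancestor in `Des b` that is not above `r`. -/
theorem exists_branch (N : NestedInstance V J) {u r b : V} (hub : u ≤ b) (hru : ¬ r ≤ u) :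
    ∃ c, u ≤ c ∧ c ≤ b ∧ ¬ r ≤ c ∧ ∀ k ≤ b, u ≤ k → ¬ r ≤ k → k ≤ c := by
  obtain ⟨c, ⟨huc, hcb, hrc⟩, hmax⟩ :=
    (Set.toFinite {k | u ≤ k ∧ k ≤ b ∧ ¬ r ≤ k}).exists_maximal ⟨u, le_rfl, hub, hru⟩
  refine ⟨c, huc, hcb, hrc, fun k hkb huk hrk => ?_⟩
  rcases N.anc_chain u k c huk huc with h1 | h1
  · exact h1
  · exact hmax ⟨huk, hkb, hrk⟩ h1

theorem exists_isFork (h : N.IsRounded x y xt) {u b : V} (hu : xt u < x u) (hub : u ≤ b)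
    (h2 : 2 ≤ ∑ k ∈ Des b, x k) (h3 : ∑ k ∈ Des b, x k < 3) :
    ∃ r cu cr, IsFork x b u r cu cr := by
  classical
  have ht := h.isTopmost_of_lt hu
  have hx := h.sum_Des_eq_sum_topmost (g := x) (fun _ h => h) ht hub
  have huT : u ∈ (Des b).filter (IsTopmost x) := Finset.mem_filter.2 ⟨mem_Des.2 hub, ht⟩
  have hcard : (((Des b).filter (IsTopmost x)).card : ℝ) ≤
      ∑ a ∈ Des b with IsTopmost x a, ∑ k ∈ Des a, x k := by
    have := Finset.sum_le_sum fun a (_ : a ∈ (Des b).filter (IsTopmost x)) => h.one_le_sum_Des a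
    simpa using this
  have hcard3 : (((Des b).filter (IsTopmost x)).card : ℝ) < 3 := by linarith
  have hcard3' : ((Des b).filter (IsTopmost x)).card < 3 := by exact_mod_cast hcard3
  obtain ⟨r, hrT, hru⟩ : ∃ r ∈ (Des b).filter (IsTopmost x), r ≠ u := by
    by_contra hno
    push Not at hno
    have : ∑ k ∈ Des b, x k = ∑ k ∈ Des u, x k :=
      h.sum_Des_eq_of_unique (fun _ h => h) ht hub fun i hi hti =>
        hno i (Finset.mem_filter.2 ⟨mem_Des.2 hi, hti⟩)
    linarith [(h.sum_of_lt hu).2]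
  have hrb := mem_Des.1 (Finset.mem_filter.1 hrT).1
  have hrt := (Finset.mem_filter.1 hrT).2
  have huniq : ∀ i ≤ b, IsTopmost x i → i = u ∨ i = r := by
    intro i hi hti
    by_contra hno
    push Not at hno
    have hsub : ({u, r, i} : Finset V) ⊆ (Des b).filter (IsTopmost x) := by
      intro a ha
      simp only [Finset.mem_insert, Finset.mem_singleton] at ha
      rcases ha with rfl | rfl | rfl
      · exact huT
      · exact hrT
      · exact Finset.mem_filter.2 ⟨mem_Des.2 hi, hti⟩
    have h4 := Finset.card_le_card hsub
    rw [Finset.card_eq_three.2 ⟨u, r, i, hru.symm, hno.1.symm, hno.2.symm, rfl⟩] at h4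
    omega
  obtain ⟨cu, huc, hcub, hrcu, hcu⟩ := exists_branch N (r := r) hub
    fun hle => hru (isTopmost_eq_of_le hrt ht hle)
  obtain ⟨cr, hrc, hcrb, hucr, hcr⟩ := exists_branch N (r := u) hrb
    fun hle => hru (isTopmost_eq_of_le ht hrt hle).symm
  refine ⟨r, cu, cr, ht, hrt, huc, hrc, hcub, hcrb, hrcu, hucr, fun k hk => ?_, huniq⟩
  obtain ⟨i, hi, hki | hik⟩ := h.exists_isTopmost_comparable k
  · have hib : i ≤ b := by
      rcases N.anc_chain k i b hki hk with h1 | h1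
      · exact h1
      · exact (isTopmost_eq_of_le ht hi (hub.trans h1)) ▸ hub
    rcases huniq i hib hi with rfl | rfl
    · exact Or.inl (hki.trans huc)
    · exact Or.inr (Or.inl (hki.trans hrc))
  · by_cases huk : u ≤ k
    · by_cases hrk : r ≤ k
      · exact Or.inr (Or.inr ⟨huk, hrk⟩)
      · exact Or.inl (hcu k hk huk hrk)
    · have hrk : r ≤ k := by
        rcases huniq i (hik.trans hk) hi with rfl | rfl
        · exact absurd hik huk
        · exact hik
      exact Or.inr (Or.inl (hcr k hk hrk huk))

namespace IsFork

variable {b u r cu cr : V}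

theorem symm {V : Type*} [PartialOrder V] {x : V → ℝ} {b u r cu cr : V}
    (hf : IsFork x b u r cu cr) : IsFork x b r u cr cu :=
  ⟨hf.topmost_right, hf.topmost_left, hf.right_le, hf.left_le, hf.le_right, hf.le_left,
    hf.not_left_le, hf.not_right_le,
    fun k hk => by rcases hf.cover k hk with h | h | h <;> tauto,
    fun i hi ht => (hf.unique i hi ht).symm⟩

theorem ne {V : Type*} [PartialOrder V] {x : V → ℝ} {b u r cu cr : V}
    (hf : IsFork x b u r cu cr) : u ≠ r := fun e => hf.not_right_le (e ▸ hf.left_le)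

theorem sum_left (hf : IsFork x b u r cu cr) (h : N.IsRounded x y xt) {g : V → ℝ}
    (hg : ∀ k, x k = 0 → g k = 0) : ∑ k ∈ Des cu, g k = ∑ k ∈ Des u, g k := by
  refine h.sum_Des_eq_of_unique hg hf.topmost_left hf.left_le fun i hi ht => ?_
  rcases hf.unique i (hi.trans hf.le_left) ht with e | rfl
  · exact e
  · exact absurd hi hf.not_right_le

theorem sum_right (hf : IsFork x b u r cu cr) (h : N.IsRounded x y xt) {g : V → ℝ}
    (hg : ∀ k, x k = 0 → g k = 0) : ∑ k ∈ Des cr, g k = ∑ k ∈ Des r, g k :=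
  hf.symm.sum_left h hg

theorem sum (hf : IsFork x b u r cu cr) (h : N.IsRounded x y xt) {g : V → ℝ}
    (hg : ∀ k, x k = 0 → g k = 0) :
    ∑ k ∈ Des b, g k = ∑ k ∈ Des u, g k + ∑ k ∈ Des r, g k := by
  classical
  rw [h.sum_Des_eq_sum_topmost hg hf.topmost_left (hf.left_le.trans hf.le_left)]
  have : (Des b).filter (IsTopmost x) = {u, r} := by
    ext a
    rw [Finset.mem_filter, Finset.mem_insert, Finset.mem_singleton, mem_Des]
    constructor
    · exact fun ha => hf.unique a ha.1 ha.2
    · rintro (rfl | rfl)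
      · exact ⟨hf.left_le.trans hf.le_left, hf.topmost_left⟩
      · exact ⟨hf.right_le.trans hf.le_right, hf.topmost_right⟩
  rw [this, Finset.sum_pair hf.ne]

/-- No node below a node on the path from `r` to `cr` lies in the left branch. -/
theorem not_le_left (hf : IsFork x b u r cu cr) (N : NestedInstance V J) {k a : V}
    (hka : k ≤ a) (hra : r ≤ a) (ha : a ≤ cr) : ¬ k ≤ cu := by
  intro hk
  rcases N.anc_chain k a cu hka hk with h | h
  · exact hf.not_right_le (hra.trans h)
  · exact hf.not_left_le (hf.left_le.trans (h.trans ha))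

/-- When `u` is rounded down, exactly two slots are open in the subtree of `r`. -/
theorem sum_right_eq_two (hf : IsFork x b u r cu cr) (h : N.IsRounded x y xt)
    (hu : xt u < x u) (h2 : 2 ≤ ∑ k ∈ Des b, x k) (h3 : ∑ k ∈ Des b, x k < 3) :
    ∑ k ∈ Des r, xt k = 2 ∧ ∑ k ∈ Des r, x k < 2 := by
  have hbud := h.budget u b hu (hf.left_le.trans hf.le_left)
  have hx := hf.sum h (g := x) fun _ h => h
  have hxt := hf.sum h (g := xt) fun _ => h.eq_zero
  have h1 := h.one_le_sum_Des u
  have hlt := h.sum_xt_lt hf.topmost_right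
  obtain ⟨m, hm⟩ := h.exists_nat_sum_xt (i := r)
  rw [(h.sum_of_lt hu).1] at hxt
  have hr2 : ∑ k ∈ Des r, x k < 2 := by linarith
  refine ⟨?_, hr2⟩
  have hm1 : (1 : ℝ) < m := by linarith
  have hm3 : (m : ℝ) < 3 := by linarith
  have hm1' : 1 < m := by exact_mod_cast hm1
  have hm3' : m < 3 := by exact_mod_cast hm3
  have : m = 2 := by omega
  rw [hm, this]
  norm_num

end IsFork

end IsRounded

/-! ### Loads and demands -/

theorem exists_schedulable_of_OPT_le (N : NestedInstance V J) {i : V} {m : ℕ}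
    (hi : N.OPT i ≤ m) : ∃ O : Finset N.Slot, O.card ≤ m ∧ N.Schedulable (N.jobsDes i) O := by
  by_contra hno
  push Not at hno
  have : ((m + 1 : ℕ) : ℕ∞) ≤ N.OPT i := by
    refine le_iInf₂ fun O hO => ?_
    have := hno O
    have h1 : m < O.card := by
      by_contra hle
      exact this (not_lt.1 hle) hO
    exact_mod_cast h1
  have h2 := this.trans hi
  have h3 : m + 1 ≤ m := by exact_mod_cast h2
  omega

theorem LPFeasible.OPT_le_one {N : NestedInstance V J} {x : V → ℝ} {y : V → J → ℝ}
    (hLP : N.LPFeasible x y) {i : V} (hi : ∑ k ∈ Des i, x k < 2) : N.OPT i ≤ (1 : ℕ) := by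
  by_contra hgt
  have h2 : (2 : ℕ∞) ≤ N.OPT i := by
    have := Order.add_one_le_of_lt (not_le.1 hgt)
    simpa [one_add_one_eq_two] using this
  linarith [hLP.opt_two i h2]

theorem LPFeasible.OPT_le_two {N : NestedInstance V J} {x : V → ℝ} {y : V → J → ℝ}
    (hLP : N.LPFeasible x y) {i : V} (hi : ∑ k ∈ Des i, x k < 3) : N.OPT i ≤ (2 : ℕ) := by
  by_contra hgt
  have h2 : (3 : ℕ∞) ≤ N.OPT i := by
    have := Order.add_one_le_of_lt (not_le.1 hgt)
    simpa [two_add_one_eq_three] using this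
  linarith [hLP.opt_three i h2]

section Load

variable (N : NestedInstance V J)

open scoped Classical in
theorem mem_jobsAnc {J' : Finset J} {i : V} {j : J} :
    j ∈ N.jobsAnc J' i ↔ j ∈ J' ∧ i ≤ N.node j := by
  rw [jobsAnc, Finset.mem_filter]

theorem jobsAnc_anti (J' : Finset J) {i k : V} (hik : i ≤ k) :
    N.jobsAnc J' k ⊆ N.jobsAnc J' i := fun _ hj =>
  (N.mem_jobsAnc).2 ⟨((N.mem_jobsAnc).1 hj).1, hik.trans ((N.mem_jobsAnc).1 hj).2⟩

/-- The number of jobs of `J'` that one slot of node `i` can serve. -/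
noncomputable def load (J' : Finset J) (i : V) : ℝ :=
  ((min (N.jobsAnc J' i).card N.cap : ℕ) : ℝ)

open scoped Classical in
/-- The jobs of `J'` that sit strictly above node `i`. -/
noncomputable def jobsAbove (J' : Finset J) (i : V) : Finset J :=
  J'.filter fun j => i < N.node j

open scoped Classical in
/-- The jobs of `J'` that sit in the subtree of node `i`. -/
noncomputable def jobsBelow (J' : Finset J) (i : V) : Finset J :=
  J'.filter fun j => N.node j ≤ i

/-- The number of jobs sitting strictly above node `i` that one slot below `i` can serve. -/
noncomputable def loadAbove (J' : Finset J) (i : V) : ℝ :=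
  ((min (N.jobsAbove J' i).card N.cap : ℕ) : ℝ)

variable {N} {J' : Finset J}

open scoped Classical in
theorem mem_jobsAbove {i : V} {j : J} : j ∈ N.jobsAbove J' i ↔ j ∈ J' ∧ i < N.node j := by
  rw [jobsAbove, Finset.mem_filter]

open scoped Classical in
theorem mem_jobsBelow {i : V} {j : J} : j ∈ N.jobsBelow J' i ↔ j ∈ J' ∧ N.node j ≤ i := by
  rw [jobsBelow, Finset.mem_filter]

theorem disjoint_jobsBelow_jobsAbove (i : V) :
    Disjoint (N.jobsBelow J' i) (N.jobsAbove J' i) :=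
  Finset.disjoint_left.2 fun _ h1 h2 =>
    ((mem_jobsBelow.1 h1).2.trans_lt (mem_jobsAbove.1 h2).2).false

theorem jobsAbove_subset_jobsAnc {i b : V} (hib : i ≤ b) :
    N.jobsAbove J' b ⊆ N.jobsAnc J' i := fun _ hj =>
  (N.mem_jobsAnc).2 ⟨(mem_jobsAbove.1 hj).1, hib.trans (mem_jobsAbove.1 hj).2.le⟩

theorem load_nonneg (i : V) : 0 ≤ N.load J' i := Nat.cast_nonneg _

theorem loadAbove_nonneg (i : V) : 0 ≤ N.loadAbove J' i := Nat.cast_nonneg _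

theorem load_anti {i k : V} (hik : i ≤ k) : N.load J' k ≤ N.load J' i := by
  unfold load
  exact_mod_cast min_le_min_right _ (Finset.card_le_card (N.jobsAnc_anti J' hik))

theorem loadAbove_le_load {i b : V} (hib : i ≤ b) : N.loadAbove J' b ≤ N.load J' i := by
  unfold load loadAbove
  exact_mod_cast min_le_min_right _ (Finset.card_le_card (jobsAbove_subset_jobsAnc hib))

theorem load_eq_cap {i : V} (hi : N.cap ≤ (N.jobsAnc J' i).card) : N.load J' i = N.cap := by
  rw [load, min_eq_right hi]

theorem load_eq_card {i : V} (hi : (N.jobsAnc J' i).card ≤ N.cap) :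
    N.load J' i = (N.jobsAnc J' i).card := by
  rw [load, min_eq_left hi]

theorem lt_iff_le_of_covBy (N : NestedInstance V J) {c b k : V} (hc : c ⋖ b) :
    c < k ↔ b ≤ k := by
  refine ⟨fun hck => ?_, fun hbk => hc.lt.trans_le hbk⟩
  rcases N.anc_chain c b k hc.le hck.le with h | h
  · exact h
  · rcases h.eq_or_lt with rfl | h
    · exact le_rfl
    · exact absurd h (hc.2 hck)

theorem jobsAbove_eq_of_covBy {c b : V} (hc : c ⋖ b) :
    N.jobsAbove J' c = N.jobsAnc J' b := by
  ext j
  rw [mem_jobsAbove, mem_jobsAnc, lt_iff_le_of_covBy N hc]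

theorem loadAbove_eq_of_covBy {c b : V} (hc : c ⋖ b) :
    N.loadAbove J' c = N.load J' b := by
  rw [loadAbove, load, jobsAbove_eq_of_covBy hc]

variable {x : V → ℝ} {y : V → J → ℝ}

theorem LPFeasible.sum_y_eq (hLP : N.LPFeasible x y) (i : V) :
    ∑ j ∈ J', y i j = ∑ j ∈ N.jobsAnc J' i, y i j := by
  refine (Finset.sum_subset (fun j hj => (N.mem_jobsAnc.1 hj).1) fun j hj hj' => ?_).symm
  exact hLP.y_eq_zero i j fun h => hj' (N.mem_jobsAnc.2 ⟨hj, (N.mem_jobsAnc.1 h).2⟩)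

theorem LPFeasible.sum_y_le_cap (hLP : N.LPFeasible x y) (i : V) :
    ∑ j ∈ J', y i j ≤ N.cap * x i := by
  rw [hLP.sum_y_eq]
  refine (Finset.sum_le_sum_of_subset_of_nonneg (fun j hj => ?_)
    fun j _ _ => hLP.y_nonneg i j).trans (hLP.capacity i)
  exact N.mem_jobsAnc.2 ⟨Finset.mem_univ _, (N.mem_jobsAnc.1 hj).2⟩

theorem LPFeasible.sum_y_le_load (hLP : N.LPFeasible x y) (i : V) :
    ∑ j ∈ J', y i j ≤ N.load J' i * x i := by
  rcases le_total (N.jobsAnc J' i).card N.cap with h | h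
  · rw [load_eq_card h, hLP.sum_y_eq]
    refine (Finset.sum_le_sum fun j _ => hLP.y_le_x i j).trans ?_
    simp
  · rw [load_eq_cap h]
    exact hLP.sum_y_le_cap i

theorem LPFeasible.y_eq_zero_of_x (hLP : N.LPFeasible x y) {i : V} (hi : x i = 0) (j : J) :
    y i j = 0 :=
  le_antisymm (hi ▸ hLP.y_le_x i j) (hLP.y_nonneg i j)

theorem LPFeasible.size_le (hLP : N.LPFeasible x y) {j : J} {b : V} (hj : N.node j ≤ b) :
    (N.size j : ℝ) ≤ ∑ i ∈ Des b, y i j :=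
  (hLP.scheduled j).trans (Finset.sum_le_sum_of_subset_of_nonneg
    (fun _ hk => mem_Des.2 ((mem_Des.1 hk).trans hj)) fun i _ _ => hLP.y_nonneg i j)

theorem LPFeasible.sum_y_le_sum_x (hLP : N.LPFeasible x y) (S : Finset V) (j : J) :
    ∑ i ∈ S, y i j ≤ ∑ i ∈ S, x i :=
  Finset.sum_le_sum fun i _ => hLP.y_le_x i j

variable (N) in
/-- The part of the demand of `J'` that is served in the subtree of `b`: the sizes of the jobs
sitting there, together with the fractions of the jobs sitting above. -/
noncomputable def demand (y : V → J → ℝ) (J' : Finset J) (b : V) : ℝ :=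
  ∑ j ∈ N.jobsBelow J' b, (N.size j : ℝ) + ∑ j ∈ N.jobsAbove J' b, ∑ i ∈ Des b, y i j

theorem LPFeasible.demand_le_sum_y (hLP : N.LPFeasible x y) (b : V) :
    N.demand y J' b ≤ ∑ i ∈ Des b, ∑ j ∈ J', y i j := by
  classical
  rw [Finset.sum_comm]
  have h1 : ∑ j ∈ N.jobsBelow J' b, (N.size j : ℝ) ≤
      ∑ j ∈ N.jobsBelow J' b, ∑ i ∈ Des b, y i j :=
    Finset.sum_le_sum fun j hj => hLP.size_le (mem_jobsBelow.1 hj).2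
  refine (add_le_add_left h1 _).trans ?_
  rw [← Finset.sum_union (disjoint_jobsBelow_jobsAbove b)]
  refine Finset.sum_le_sum_of_subset_of_nonneg (Finset.union_subset
    (fun j hj => (mem_jobsBelow.1 hj).1) fun j hj => (mem_jobsAbove.1 hj).1) fun j _ _ => ?_
  exact Finset.sum_nonneg fun i _ => hLP.y_nonneg i j

theorem LPFeasible.demand_le_load (hLP : N.LPFeasible x y) (b : V) :
    N.demand y J' b ≤ ∑ i ∈ Des b, N.load J' i * x i :=
  (hLP.demand_le_sum_y b).trans (Finset.sum_le_sum fun i _ => hLP.sum_y_le_load i)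

theorem LPFeasible.demand_le_cap (hLP : N.LPFeasible x y) (b : V) :
    N.demand y J' b ≤ N.cap * ∑ i ∈ Des b, x i := by
  rw [Finset.mul_sum]
  exact (hLP.demand_le_sum_y b).trans (Finset.sum_le_sum fun i _ => hLP.sum_y_le_cap i)

/-- Jobs that can be scheduled in a single slot are at most `cap` many and have size one. -/
theorem Schedulable.of_card_le_one {S : Finset J} {O : Finset N.Slot} (hO : O.card ≤ 1)
    (hS : N.Schedulable S O) : S.card ≤ N.cap ∧ ∀ j ∈ S, N.size j = 1 := by
  classical
  obtain ⟨σ, hσ, hcap⟩ := hS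
  have hsize : ∀ j ∈ S, N.size j = 1 := by
    intro j hj
    have h1 := Finset.card_le_card (hσ j hj).1
    rw [(hσ j hj).2.1] at h1
    have := N.size_pos j
    omega
  refine ⟨?_, hsize⟩
  rcases S.eq_empty_or_nonempty with rfl | ⟨j₀, hj₀⟩
  · simp
  · have hcard : ∀ j ∈ S, (σ j).card = 1 := fun j hj => by rw [(hσ j hj).2.1, hsize j hj]
    obtain ⟨s, hs⟩ := Finset.card_eq_one.1 (hcard j₀ hj₀)
    refine le_trans (Finset.card_le_card fun j hj => ?_) (hcap s)
    refine Finset.mem_filter.2 ⟨hj, ?_⟩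
    obtain ⟨s', hs'⟩ := Finset.card_eq_one.1 (hcard j hj)
    have h1 : s ∈ O := (hσ j₀ hj₀).1 (by simp [hs])
    have h2 : s' ∈ O := (hσ j hj).1 (by simp [hs'])
    rw [hs', Finset.card_le_one.1 hO s h1 s' h2]
    simp

end Load

end NestedInstance

/-! ### The surplus of a subtree -/

namespace NestedInstance

variable {V J : Type*} [Fintype V] [PartialOrder V] [Fintype J]

namespace IsRounded

variable {N : NestedInstance V J} {x : V → ℝ} {y : V → J → ℝ} {xt : V → ℝ} {J' : Finset J}

/-- Without lowered nodes the supply dominates the fractional supply node by node. -/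
theorem demand_add_le_of_loweredNodes_eq_empty (h : N.IsRounded x y xt) {b : V}
    (hb : loweredNodes x xt b = ∅) :
    N.demand y J' b + N.loadAbove J' b *
      (∑ i ∈ Des b, xt i - ∑ i ∈ Des b, x i - (loweredNodes x xt b).card) ≤
      ∑ i ∈ Des b, N.load J' i * xt i := by
  rw [hb, Finset.card_empty, Nat.cast_zero, sub_zero, ← Finset.sum_sub_distrib, Finset.mul_sum]
  have h1 := h.lp.demand_le_load (J' := J') b
  have h2 : ∑ i ∈ Des b, N.loadAbove J' b * (xt i - x i) ≤
      ∑ i ∈ Des b, N.load J' i * (xt i - x i) := by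
    refine Finset.sum_le_sum fun i hi => mul_le_mul_of_nonneg_right
      (loadAbove_le_load (mem_Des.1 hi)) (sub_nonneg.2 (not_lt.1 fun hlt => ?_))
    have : i ∈ loweredNodes x xt b := mem_loweredNodes.2 ⟨mem_Des.1 hi, hlt⟩
    simp [hb] at this
  simp only [mul_sub, Finset.sum_sub_distrib] at h2 ⊢
  linarith

theorem load_mul_nonneg (h : N.IsRounded x y xt) (i : V) : 0 ≤ N.load J' i * xt i :=
  mul_nonneg (load_nonneg i) (h.nonneg i)

theorem load_le_sum (h : N.IsRounded x y xt) {l b : V} (hl : IsMin l) (hlb : l ≤ b) :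
    N.load J' l ≤ ∑ i ∈ Des b, N.load J' i * xt i := by
  refine le_trans ?_ (Finset.single_le_sum (fun i _ => h.load_mul_nonneg i) (mem_Des.2 hlb))
  exact le_mul_of_one_le_right (load_nonneg l) (h.one_le_of_one_le (h.one_le_leaf l hl))

/-- In a subtree with less than two units all jobs have size one, and one slot holds them. -/
theorem jobsBelow_of_sum_lt_two (h : N.IsRounded x y xt) {b : V}
    (hb : ∑ k ∈ Des b, x k < 2) :
    (N.jobsBelow J' b).card ≤ N.cap ∧ ∀ j ∈ N.jobsBelow J' b, N.size j = 1 := by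
  classical
  obtain ⟨O, hO, hS⟩ := N.exists_schedulable_of_OPT_le (h.lp.OPT_le_one hb)
  obtain ⟨h1, h2⟩ := hS.of_card_le_one hO
  have hsub : N.jobsBelow J' b ⊆ N.jobsDes b := fun j hj => by
    rw [jobsDes, Finset.mem_filter]
    exact ⟨Finset.mem_univ _, (mem_jobsBelow.1 hj).2⟩
  exact ⟨(Finset.card_le_card hsub).trans h1, fun j hj => h2 j (hsub hj)⟩

theorem sum_size_eq_card {S : Finset J} (hS : ∀ j ∈ S, N.size j = 1) :
    ∑ j ∈ S, (N.size j : ℝ) = S.card := by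
  rw [Finset.sum_congr rfl fun j hj => by rw [hS j hj]]
  simp

theorem sum_sum_y_le (h : N.IsRounded x y xt) (A : Finset J) (S : Finset V) :
    ∑ j ∈ A, ∑ i ∈ S, y i j ≤ A.card * ∑ i ∈ S, x i := by
  refine (Finset.sum_le_sum fun j _ => h.lp.sum_y_le_sum_x S j).trans ?_
  simp

/-- The surplus of a subtree whose only topmost node is rounded down: its single open slot holds the
jobs sitting there, and the charge of one unit pays for all fractions of jobs from above. -/
theorem demand_add_le_of_sum_lt_two (h : N.IsRounded x y xt) {b u : V} (hu : xt u < x u)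
    (hub : u ≤ b) (hb : ∑ k ∈ Des b, x k < 2) :
    N.demand y J' b + N.loadAbove J' b *
      (∑ i ∈ Des b, xt i - ∑ i ∈ Des b, x i - (loweredNodes x xt b).card) ≤
      ∑ i ∈ Des b, N.load J' i * xt i := by
  classical
  have ht := h.isTopmost_of_lt hu
  have huniq := h.unique_of_sum_lt_two ht hub hb
  have hU := h.loweredNodes_eq_singleton hu hub fun i hi hti _ => huniq i hi hti
  have hxt := h.sum_Des_eq_of_unique (g := xt) (fun _ => h.eq_zero) ht hub huniq
  rw [hU, Finset.card_singleton, Nat.cast_one, hxt, (h.sum_of_lt hu).1]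
  obtain ⟨l, hl, hlb⟩ := h.exists_leaf_le hb
  have hsup := h.load_le_sum (J' := J') hl (hlb b le_rfl)
  rcases le_total (N.jobsAbove J' b).card N.cap with hA | hA
  · obtain ⟨h1, h2⟩ := h.jobsBelow_of_sum_lt_two (J' := J') hb
    have h3 : ((N.jobsBelow J' b).card : ℝ) ≤ N.load J' l := by
      unfold load
      refine Nat.cast_le.2 (le_min (Finset.card_le_card fun j hj => ?_) h1)
      exact N.mem_jobsAnc.2 ⟨(mem_jobsBelow.1 hj).1, hlb _ (mem_jobsBelow.1 hj).2⟩
    have h4 := h.sum_sum_y_le (N.jobsAbove J' b) (Des b)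
    rw [demand, sum_size_eq_card h2, loadAbove, min_eq_left hA]
    linarith
  · have h1 := h.lp.demand_le_cap (J' := J') b
    have h2 := load_nonneg (N := N) (J' := J') l
    rw [loadAbove, min_eq_right hA]
    linarith

open scoped Classical in
/-- The jobs of `J'` in the subtree of `b` that sit above both `u` and `r`. -/
noncomputable def spanningJobs (N : NestedInstance V J) (J' : Finset J) (b u r : V) : Finset J :=
  J'.filter fun j => N.node j ≤ b ∧ u ≤ N.node j ∧ r ≤ N.node j

open scoped Classical in
theorem mem_spanningJobs {b u r : V} {j : J} :
    j ∈ spanningJobs N J' b u r ↔ j ∈ J' ∧ N.node j ≤ b ∧ u ≤ N.node j ∧ r ≤ N.node j := by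
  rw [spanningJobs, Finset.mem_filter]

namespace IsFork

variable {b u r cu cr : V}

theorem disjoint_left_right (hf : IsFork x b u r cu cr) (h : N.IsRounded x y xt) :
    Disjoint (N.jobsBelow J' cu) (N.jobsBelow J' cr) := by
  refine Finset.disjoint_left.2 fun j h1 h2 => ?_
  have hl := (mem_jobsBelow.1 h1).2
  have hr := (mem_jobsBelow.1 h2).2
  obtain ⟨i, hi, hji | hij⟩ := h.exists_isTopmost_comparable (N.node j)
  · have hib : i ≤ b := by
      rcases N.anc_chain _ i b hji (hl.trans hf.le_left) with h1 | h1
      · exact h1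
      · exact (isTopmost_eq_of_le hf.topmost_left hi
          ((hf.left_le.trans hf.le_left).trans h1)) ▸ hf.left_le.trans hf.le_left
    rcases hf.unique i hib hi with rfl | rfl
    · exact hf.symm.not_le_left N hji le_rfl hf.left_le hr
    · exact hf.not_le_left N hji le_rfl hf.right_le hl
  · rcases hf.unique i (hij.trans (hl.trans hf.le_left)) hi with rfl | rfl
    · exact hf.not_left_le (hij.trans hr)
    · exact hf.not_right_le (hij.trans hl)

theorem disjoint_left_spanning (hf : IsFork x b u r cu cr) :
    Disjoint (N.jobsBelow J' cu) (spanningJobs N J' b u r) :=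
  Finset.disjoint_left.2 fun _ h1 h2 =>
    hf.not_right_le ((mem_spanningJobs.1 h2).2.2.2.trans (mem_jobsBelow.1 h1).2)

theorem disjoint_right_spanning (hf : IsFork x b u r cu cr) :
    Disjoint (N.jobsBelow J' cr) (spanningJobs N J' b u r) :=
  Finset.disjoint_left.2 fun _ h1 h2 =>
    hf.not_left_le ((mem_spanningJobs.1 h2).2.2.1.trans (mem_jobsBelow.1 h1).2)

open scoped Classical in
theorem jobsBelow_eq (hf : IsFork x b u r cu cr) :
    N.jobsBelow J' b =
      N.jobsBelow J' cu ∪ (N.jobsBelow J' cr ∪ spanningJobs N J' b u r) := by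
  ext j
  simp only [Finset.mem_union, mem_jobsBelow, mem_spanningJobs]
  constructor
  · rintro ⟨h1, h2⟩
    rcases hf.cover _ h2 with h3 | h3 | h3 <;> tauto
  · rintro (⟨h1, h2⟩ | ⟨h1, h2⟩ | ⟨h1, h2, -⟩)
    · exact ⟨h1, h2.trans hf.le_left⟩
    · exact ⟨h1, h2.trans hf.le_right⟩
    · exact ⟨h1, h2⟩

theorem sum_jobsBelow (hf : IsFork x b u r cu cr) (h : N.IsRounded x y xt) (F : J → ℝ) :
    ∑ j ∈ N.jobsBelow J' b, F j = ∑ j ∈ N.jobsBelow J' cu, F j +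
      ∑ j ∈ N.jobsBelow J' cr, F j + ∑ j ∈ spanningJobs N J' b u r, F j := by
  classical
  rw [hf.jobsBelow_eq, Finset.sum_union, Finset.sum_union hf.disjoint_right_spanning, add_assoc]
  exact Finset.disjoint_union_right.2 ⟨hf.disjoint_left_right h, hf.disjoint_left_spanning⟩

theorem disjoint_spanning_above :
    Disjoint (spanningJobs N J' b u r) (N.jobsAbove J' b) :=
  Finset.disjoint_left.2 fun _ h1 h2 =>
    ((mem_spanningJobs.1 h1).2.1.trans_lt (mem_jobsAbove.1 h2).2).false

/-- Jobs at or below `c`, jobs spanning the fork and jobs above `b` are distinct jobs. -/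
theorem card_add_card_le {c i : V} {P : Finset J} (hP : P ⊆ N.jobsBelow J' c) (hcb : c ≤ b)
    (hPB : Disjoint P (spanningJobs N J' b u r)) (hPi : P ⊆ N.jobsAnc J' i)
    (hi : i ≤ u ∨ i ≤ r) (hib : i ≤ b) :
    P.card + (spanningJobs N J' b u r).card + (N.jobsAbove J' b).card ≤
      (N.jobsAnc J' i).card := by
  classical
  have hPA : Disjoint P (N.jobsAbove J' b) := Finset.disjoint_left.2 fun j h1 h2 =>
    (((mem_jobsBelow.1 (hP h1)).2.trans hcb).trans_lt (mem_jobsAbove.1 h2).2).false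
  rw [← Finset.card_union_of_disjoint hPB, ← Finset.card_union_of_disjoint
    (Finset.disjoint_union_left.2 ⟨hPA, disjoint_spanning_above⟩)]
  refine Finset.card_le_card (Finset.union_subset (Finset.union_subset hPi fun j hj => ?_)
    (jobsAbove_subset_jobsAnc hib))
  obtain ⟨h1, -, h2, h3⟩ := mem_spanningJobs.1 hj
  exact N.mem_jobsAnc.2 ⟨h1, hi.elim (fun h => h.trans h2) fun h => h.trans h3⟩

/-- If both branches need a slot and all spanning jobs have size two, then in an optimal schedule
with two slots the slot of the left branch holds all left and all spanning jobs. -/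
theorem card_left_add_card_spanning_le (hf : IsFork x b u r cu cr) (h : N.IsRounded x y xt)
    (h3 : ∑ k ∈ Des b, x k < 3) (hcu : (N.jobsBelow J' cu).card ≤ N.cap)
    (hB : ∀ j ∈ spanningJobs N J' b u r, 2 ≤ N.size j) {j₀ : J} (hj₀ : N.node j₀ ≤ r) :
    (N.jobsBelow J' cu).card + (spanningJobs N J' b u r).card ≤ N.cap := by
  classical
  rcases (spanningJobs N J' b u r).eq_empty_or_nonempty with hE | ⟨jB, hjB⟩
  · simpa [hE] using hcu
  obtain ⟨O, hO, σ, hσ, hcap⟩ := N.exists_schedulable_of_OPT_le (h.lp.OPT_le_two h3)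
  have hmem : ∀ j, N.node j ≤ b → j ∈ N.jobsDes b := fun j hj => by
    rw [jobsDes, Finset.mem_filter]
    exact ⟨Finset.mem_univ _, hj⟩
  have hBmem : ∀ j ∈ spanningJobs N J' b u r, j ∈ N.jobsDes b := fun j hj =>
    hmem j (mem_spanningJobs.1 hj).2.1
  have hBσ : ∀ j ∈ spanningJobs N J' b u r, σ j = O := fun j hj => by
    obtain ⟨h1, h2, -⟩ := hσ j (hBmem j hj)
    exact Finset.eq_of_subset_of_card_le h1 (by rw [h2]; exact hO.trans (hB j hj))
  have hne : ∀ j ∈ N.jobsDes b, (σ j).Nonempty := fun j hj => by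
    rw [← Finset.card_pos, (hσ j hj).2.1]
    exact N.size_pos j
  have hj₀b : j₀ ∈ N.jobsDes b := hmem j₀ (hj₀.trans (hf.right_le.trans hf.le_right))
  obtain ⟨sr, hsr⟩ := hne j₀ hj₀b
  have hsrr : sr.1 ≤ r := ((hσ j₀ hj₀b).2.2 sr hsr).trans hj₀
  have hsrO := (hσ j₀ hj₀b).1 hsr
  have hO2 : 2 ≤ O.card := by
    rw [← hBσ jB hjB, (hσ jB (hBmem jB hjB)).2.1]
    exact hB jB hjB
  obtain ⟨s, hsO, hs⟩ := Finset.exists_mem_ne (by omega : 1 < O.card) sr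
  have hOpair : ∀ t ∈ O, t ≠ sr → t = s := by
    intro t ht hne
    by_contra hts
    have : ({t, sr, s} : Finset N.Slot) ⊆ O := by
      intro a ha
      simp only [Finset.mem_insert, Finset.mem_singleton] at ha
      rcases ha with rfl | rfl | rfl <;> assumption
    have h4 := Finset.card_le_card this
    rw [Finset.card_eq_three.2 ⟨t, sr, s, hne, hts, hs.symm, rfl⟩] at h4
    omega
  rw [← Finset.card_union_of_disjoint hf.disjoint_left_spanning]
  refine (Finset.card_le_card fun j hj => ?_).trans (hcap s)
  rw [Finset.mem_filter]
  rcases Finset.mem_union.1 hj with hj | hj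
  · have hju := (mem_jobsBelow.1 hj).2
    have hjb := hmem j (hju.trans hf.le_left)
    obtain ⟨t, ht⟩ := hne j hjb
    have htcu := ((hσ j hjb).2.2 t ht).trans hju
    have : t = s := hOpair t ((hσ j hjb).1 ht) fun e =>
      hf.not_le_left N hsrr le_rfl hf.right_le (e ▸ htcu)
    exact ⟨hjb, this ▸ ht⟩
  · exact ⟨hBmem j hj, by rwa [hBσ j hj]⟩

end IsFork

end IsRounded

end NestedInstance

/-! ### Subtrees with two topmost nodes -/

namespace NestedInstance

variable {V J : Type*} [Fintype V] [PartialOrder V] [Fintype J]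

namespace IsRounded

variable {N : NestedInstance V J} {x : V → ℝ} {y : V → J → ℝ} {xt : V → ℝ} {J' : Finset J}

namespace IsFork

variable {b u r cu cr : V}

/-- If the slots of `r` are not saturated, spanning jobs of an irreducible set have size at least
two, as they exceed the number of unsaturated slots below them. -/
theorem two_le_size_of_mem_spanning (h : N.IsRounded x y xt) (hirr : N.Irreducible xt J')
    (hr : (N.jobsAnc J' r).card ≤ N.cap) (hxr : 1 ≤ xt r) {j : J}
    (hj : j ∈ spanningJobs N J' b u r) : 2 ≤ N.size j := by
  classical
  obtain ⟨hjJ, -, -, hrj⟩ := mem_spanningJobs.1 hj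
  have h1 := hirr j hjJ
  have h2 : xt r ≤ _ := Finset.single_le_sum (fun k _ => h.nonneg k)
    (Finset.mem_filter (p := fun k => (N.jobsAnc J' k).card ≤ N.cap).2 ⟨mem_Des.2 hrj, hr⟩)
  have h3 : (1 : ℝ) < N.size j := by linarith
  exact_mod_cast h3

theorem size_le_two (h : N.IsRounded x y xt) (h3 : ∑ k ∈ Des b, x k < 3) {j : J}
    (hjb : N.node j ≤ b) : N.size j ≤ 2 := by
  classical
  obtain ⟨O, hO, σ, hσ, -⟩ := N.exists_schedulable_of_OPT_le (h.lp.OPT_le_two h3)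
  have hjd : j ∈ N.jobsDes b := by
    rw [jobsDes, Finset.mem_filter]
    exact ⟨Finset.mem_univ _, hjb⟩
  have h5 := (Finset.card_le_card (hσ j hjd).1).trans hO
  rwa [(hσ j hjd).2.1] at h5

/-- If no slot below `r` is saturated, an irreducible set has no spanning jobs. -/
theorem spanningJobs_eq_empty (h : N.IsRounded x y xt) (hirr : N.Irreducible xt J')
    (h3 : ∑ k ∈ Des b, x k < 3) (hr2 : 2 ≤ ∑ k ∈ Des r, xt k)
    (hr : ∀ k ≤ r, (N.jobsAnc J' k).card ≤ N.cap) : spanningJobs N J' b u r = ∅ := by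
  classical
  refine Finset.eq_empty_of_forall_notMem fun j hj => ?_
  obtain ⟨hjJ, hjb, -, hrj⟩ := mem_spanningJobs.1 hj
  have h1 := hirr j hjJ
  have h2 : ∑ k ∈ Des r, xt k ≤ _ := Finset.sum_le_sum_of_subset_of_nonneg
    (s := Des r) (t := (Des (N.node j)).filter fun k => (N.jobsAnc J' k).card ≤ N.cap)
    (fun k hk => Finset.mem_filter.2 ⟨mem_Des.2 ((mem_Des.1 hk).trans hrj),
      hr k (mem_Des.1 hk)⟩) (fun k _ _ => h.nonneg k)
  have h4 : (2 : ℝ) < N.size j := by linarith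
  have h6 : (N.size j : ℝ) ≤ 2 := by exact_mod_cast size_le_two h h3 hjb
  linarith

/-- The supply below `r` compared with the fractional supply. -/
theorem sum_load_right (h : N.IsRounded x y xt) (hr : IsTopmost x r) :
    ∑ i ∈ Des r, N.load J' i * xt i = ∑ i ∈ Des r, N.load J' i * x i +
      N.load J' r * (∑ i ∈ Des r, xt i - ∑ i ∈ Des r, x i) := by
  rw [← Finset.sum_sub_distrib, Finset.mul_sum, ← Finset.sum_add_distrib]
  refine Finset.sum_congr rfl fun i hi => ?_
  by_cases hir : i = r
  · rw [hir]
    ring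
  · rw [h.eq_of_not_isTopmost fun ht => hir (isTopmost_eq_of_le ht hr (mem_Des.1 hi))]
    ring

/-- The leaf and the topmost node `r` above it each have an open slot. -/
theorem load_add_load_le (h : N.IsRounded x y xt) {l : V} (hl : IsMin l) (hlr : l ≤ r)
    (hr2 : ∑ k ∈ Des r, xt k = 2) :
    N.load J' l + N.load J' r ≤ ∑ i ∈ Des r, N.load J' i * xt i := by
  have h1 : (N.load J' l - N.load J' r) * xt l ≤
      ∑ i ∈ Des r, (N.load J' i - N.load J' r) * xt i :=
    Finset.single_le_sum (f := fun i => (N.load J' i - N.load J' r) * xt i)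
      (fun i hi => mul_nonneg (sub_nonneg.2 (load_anti (mem_Des.1 hi))) (h.nonneg i))
      (mem_Des.2 hlr)
  have h2 : N.load J' l - N.load J' r ≤ (N.load J' l - N.load J' r) * xt l :=
    le_mul_of_one_le_right (sub_nonneg.2 (load_anti hlr))
      (h.one_le_of_one_le (h.one_le_leaf l hl))
  have h3 : ∑ i ∈ Des r, (N.load J' i - N.load J' r) * xt i =
      ∑ i ∈ Des r, N.load J' i * xt i - N.load J' r * 2 := by
    rw [← hr2, Finset.mul_sum, ← Finset.sum_sub_distrib]
    exact Finset.sum_congr rfl fun i _ => by ring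
  linarith

/-- A bound on the demand that is sharp enough when the left slot is not saturated: the left jobs
have size one, the other jobs use at most `x (Des u)` each in the left branch, and the demand of the
right branch is at most its fractional supply. -/
theorem demand_le_of_left (hf : IsFork x b u r cu cr) (h : N.IsRounded x y xt)
    (hsz : ∀ j ∈ N.jobsBelow J' cu, N.size j = 1) :
    N.demand y J' b ≤ (N.jobsBelow J' cu).card +
      ((spanningJobs N J' b u r).card + (N.jobsAbove J' b).card) * ∑ k ∈ Des u, x k +
      ∑ i ∈ Des r, N.load J' i * x i := by
  classical
  have hy : ∀ j, ∀ k, x k = 0 → y k j = 0 := fun j k hk => h.lp.y_eq_zero_of_x hk j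
  have h1 : ∑ j ∈ N.jobsBelow J' cr, (N.size j : ℝ) ≤
      ∑ j ∈ N.jobsBelow J' cr, ∑ i ∈ Des r, y i j := by
    refine Finset.sum_le_sum fun j hj => ?_
    rw [← hf.sum_right h (hy j)]
    exact h.lp.size_le (mem_jobsBelow.1 hj).2
  have h2 : ∑ j ∈ spanningJobs N J' b u r, (N.size j : ℝ) ≤
      ∑ j ∈ spanningJobs N J' b u r, ∑ i ∈ Des u, y i j +
      ∑ j ∈ spanningJobs N J' b u r, ∑ i ∈ Des r, y i j := by
    rw [← Finset.sum_add_distrib]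
    refine Finset.sum_le_sum fun j hj => ?_
    rw [← hf.sum h (hy j)]
    exact h.lp.size_le (mem_spanningJobs.1 hj).2.1
  have h3 : ∑ j ∈ N.jobsAbove J' b, ∑ i ∈ Des b, y i j =
      ∑ j ∈ N.jobsAbove J' b, ∑ i ∈ Des u, y i j +
      ∑ j ∈ N.jobsAbove J' b, ∑ i ∈ Des r, y i j := by
    rw [← Finset.sum_add_distrib]
    exact Finset.sum_congr rfl fun j _ => hf.sum h (hy j)
  have h4 : ∑ j ∈ N.jobsBelow J' cr, ∑ i ∈ Des r, y i j +
      ∑ j ∈ spanningJobs N J' b u r, ∑ i ∈ Des r, y i j +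
      ∑ j ∈ N.jobsAbove J' b, ∑ i ∈ Des r, y i j ≤ ∑ i ∈ Des r, N.load J' i * x i := by
    rw [← Finset.sum_union hf.disjoint_right_spanning, ← Finset.sum_union]
    · refine le_trans ?_ (Finset.sum_le_sum fun i _ => h.lp.sum_y_le_load (J' := J') i)
      rw [Finset.sum_comm (s := Des r)]
      refine Finset.sum_le_sum_of_subset_of_nonneg (fun j hj => ?_)
        fun j _ _ => Finset.sum_nonneg fun i _ => h.lp.y_nonneg i j
      rcases Finset.mem_union.1 hj with hj | hj
      · rcases Finset.mem_union.1 hj with hj | hj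
        · exact (mem_jobsBelow.1 hj).1
        · exact (mem_spanningJobs.1 hj).1
      · exact (mem_jobsAbove.1 hj).1
    · refine Finset.disjoint_union_left.2 ⟨?_, disjoint_spanning_above⟩
      exact Finset.disjoint_left.2 fun j h1 h2 =>
        (((mem_jobsBelow.1 h1).2.trans hf.le_right).trans_lt (mem_jobsAbove.1 h2).2).false
  have h5 := h.sum_sum_y_le (spanningJobs N J' b u r) (Des u)
  have h6 := h.sum_sum_y_le (N.jobsAbove J' b) (Des u)
  rw [demand, hf.sum_jobsBelow h, sum_size_eq_card hsz, h3]
  linarith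

/-- Strictly below `r` there is a single unit, shared by the jobs sitting there and the jobs
above `b`. -/
theorem card_low_add_sum_le (h : N.IsRounded x y xt) (hrb : r ≤ b) (hr : IsTopmost x r)
    (hr2 : ∑ k ∈ Des r, x k < 2) (P : Finset J) (hPJ : P ⊆ J') (hP : ∀ j ∈ P, N.node j < r) :
    (P.card : ℝ) + ∑ j ∈ N.jobsAbove J' b, ∑ i ∈ Des r, y i j ≤
      N.cap + (N.jobsAbove J' b).card * x r := by
  classical
  obtain ⟨M, hM, -, -⟩ := h.exists_sum_strict hr
  have hxr := hr.1
  have hM1 : (M : ℝ) ≤ 1 := by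
    have h1 := sum_Des_eq_add x r
    rw [hM] at h1
    have h2 : (M : ℝ) < 2 := by linarith
    have h3 : M < 2 := by exact_mod_cast h2
    exact_mod_cast Nat.lt_succ_iff.1 h3
  have h1 : ∑ j ∈ N.jobsAbove J' b, ∑ i ∈ Des r, y i j = ∑ j ∈ N.jobsAbove J' b, y r j +
      ∑ j ∈ N.jobsAbove J' b, ∑ i ∈ Des r with i ≠ r, y i j := by
    rw [← Finset.sum_add_distrib]
    exact Finset.sum_congr rfl fun j _ => sum_Des_eq_add (fun i => y i j) r
  have h2 : ∑ j ∈ N.jobsAbove J' b, y r j ≤ (N.jobsAbove J' b).card * x r := by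
    refine (Finset.sum_le_sum fun j _ => h.lp.y_le_x r j).trans ?_
    simp
  have h3 : (P.card : ℝ) ≤ ∑ j ∈ P, ∑ i ∈ Des r with i ≠ r, y i j := by
    have : ∑ j ∈ P, (1 : ℝ) ≤ ∑ j ∈ P, ∑ i ∈ Des r with i ≠ r, y i j := by
      refine Finset.sum_le_sum fun j hj => ?_
      have h4 : (1 : ℝ) ≤ N.size j := by exact_mod_cast N.size_pos j
      refine (h4.trans (h.lp.scheduled j)).trans ?_
      refine Finset.sum_le_sum_of_subset_of_nonneg (fun k hk => ?_) fun i _ _ => h.lp.y_nonneg i j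
      have hkr := (mem_Des.1 hk).trans_lt (hP j hj)
      exact Finset.mem_filter.2 ⟨mem_Des.2 hkr.le, hkr.ne⟩
    simpa using this
  have h4 : ∑ j ∈ P, ∑ i ∈ Des r with i ≠ r, y i j +
      ∑ j ∈ N.jobsAbove J' b, ∑ i ∈ Des r with i ≠ r, y i j ≤ N.cap * M := by
    rw [← Finset.sum_union, Finset.sum_comm, ← hM, Finset.mul_sum]
    · refine Finset.sum_le_sum fun i _ => le_trans ?_ (h.lp.sum_y_le_cap (J' := J') i)
      exact Finset.sum_le_sum_of_subset_of_nonneg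
        (Finset.union_subset hPJ fun j hj => (mem_jobsAbove.1 hj).1) fun j _ _ => h.lp.y_nonneg i j
    · exact Finset.disjoint_left.2 fun j h5 h6 =>
        ((hP j h5).trans_le (hrb.trans (mem_jobsAbove.1 h6).2.le)).false
  have h5 : (N.cap : ℝ) * M ≤ N.cap := mul_le_of_le_one_right (Nat.cast_nonneg _) hM1
  linarith

end IsFork

/-- The surplus of a subtree with at least two and less than three units, one of whose topmost
nodes is rounded down. -/
theorem demand_add_le_of_fork (h : N.IsRounded x y xt) (hirr : N.Irreducible xt J') {b u : V}
    (hu : xt u < x u) (hub : u ≤ b) (h2 : 2 ≤ ∑ k ∈ Des b, x k) (h3 : ∑ k ∈ Des b, x k < 3) :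
    N.demand y J' b + N.loadAbove J' b *
      (∑ i ∈ Des b, xt i - ∑ i ∈ Des b, x i - (loweredNodes x xt b).card) ≤
      ∑ i ∈ Des b, N.load J' i * xt i := by
  classical
  obtain ⟨r, cu, cr, hf⟩ := h.exists_isFork hu hub h2 h3
  obtain ⟨hu1, hu2⟩ := h.sum_of_lt hu
  obtain ⟨hr2, hr2'⟩ := hf.sum_right_eq_two h hu h2 h3
  have hrb := hf.right_le.trans hf.le_right
  have hrlow : x r < xt r := by
    have h1 := sum_Des_eq_add x r
    have h2 := sum_Des_eq_add xt r
    obtain ⟨M, hM, hM', -⟩ := h.exists_sum_strict hf.topmost_right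
    linarith
  have hxr1 : 1 ≤ xt r := by
    obtain ⟨m, hm, -⟩ := h.exists_nat r
    have h1 : (0 : ℝ) < m := hm ▸ hf.topmost_right.1.trans hrlow
    rw [hm]
    exact_mod_cast h1
  have hU : loweredNodes x xt b = {u} := h.loweredNodes_eq_singleton hu hub fun i hi hti hlt =>
    (hf.unique i hi hti).resolve_right fun e => by subst e; linarith
  have hX := hf.sum h (g := x) fun _ h => h
  have hXt := hf.sum h (g := xt) fun _ => h.eq_zero
  have hS := hf.sum h (g := fun i => N.load J' i * xt i) fun k hk => by
    simp only [h.eq_zero hk, mul_zero]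
  rw [hU, Finset.card_singleton, Nat.cast_one, hXt, hu1, hr2, hS]
  have hla := loadAbove_nonneg (N := N) (J' := J') b
  -- the charge of one unit is at least the gain, so it suffices that supply covers demand
  have hcharge : N.loadAbove J' b * (1 + 2 - ∑ i ∈ Des b, x i - 1) ≤ 0 :=
    mul_nonpos_of_nonneg_of_nonpos hla (by linarith)
  have hcu2 : ∑ k ∈ Des cu, x k < 2 := by rwa [hf.sum_left h fun _ h => h]
  have hcr2 : ∑ k ∈ Des cr, x k < 2 := by rwa [hf.sum_right h fun _ h => h]
  obtain ⟨hcuc, hcus⟩ := h.jobsBelow_of_sum_lt_two (J' := J') hcu2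
  obtain ⟨-, hcrs⟩ := h.jobsBelow_of_sum_lt_two (J' := J') hcr2
  obtain ⟨lu, hlu, hlule⟩ := h.exists_leaf_le hcu2
  obtain ⟨lr, hlr, hlrle⟩ := h.exists_leaf_le hcr2
  have hSu := h.load_le_sum (J' := J') hlu (hlule u hf.left_le)
  have hSr := IsFork.load_add_load_le (J' := J') h hlr (hlrle r hf.right_le) hr2
  have hcardu := IsFork.card_add_card_le (b := b) (u := u) (r := r) (i := lu)
    (P := N.jobsBelow J' cu) subset_rfl hf.le_left hf.disjoint_left_spanning
    (fun j hj => N.mem_jobsAnc.2 ⟨(mem_jobsBelow.1 hj).1, hlule _ (mem_jobsBelow.1 hj).2⟩)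
    (Or.inl (hlule u hf.left_le)) ((hlule u hf.left_le).trans hub)
  have hcardr := IsFork.card_add_card_le (b := b) (u := u) (r := r) (i := r)
    (P := (N.jobsBelow J' cr).filter fun j => r ≤ N.node j) (Finset.filter_subset _ _)
    hf.le_right (hf.disjoint_right_spanning.mono_left (Finset.filter_subset _ _))
    (fun j hj => N.mem_jobsAnc.2 ⟨(mem_jobsBelow.1 (Finset.mem_filter.1 hj).1).1,
      (Finset.mem_filter.1 hj).2⟩)
    (Or.inr le_rfl) hrb
  have hcardu' : ((N.jobsBelow J' cu).card : ℝ) + (spanningJobs N J' b u r).card +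
      (N.jobsAbove J' b).card ≤ (N.jobsAnc J' lu).card := by exact_mod_cast hcardu
  have hcardr' : (((N.jobsBelow J' cr).filter fun j => r ≤ N.node j).card : ℝ) +
      (spanningJobs N J' b u r).card + (N.jobsAbove J' b).card ≤ (N.jobsAnc J' r).card := by
    exact_mod_cast hcardr
  rcases le_or_gt (N.jobsAnc J' lu).card N.cap with hheavyu | hheavyu
  · -- the left slot is not saturated
    have h4 := hf.demand_le_of_left h hcus
    have h5 := IsFork.sum_load_right (J' := J') h hf.topmost_right
    rw [hr2] at h5
    have h6 : ((spanningJobs N J' b u r).card + (N.jobsAbove J' b).card : ℝ) ≤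
        N.load J' r := by
      unfold load
      have : (spanningJobs N J' b u r).card + (N.jobsAbove J' b).card ≤
        min (N.jobsAnc J' r).card N.cap := le_min (by omega) (by omega)
      exact_mod_cast this
    have h7 := mul_le_mul_of_nonneg_right h6 (by linarith : 0 ≤ 2 - ∑ k ∈ Des r, x k)
    rw [load_eq_card hheavyu] at hSu
    have h8 : (0 : ℝ) ≤ (spanningJobs N J' b u r).card + (N.jobsAbove J' b).card := by positivity
    have h9 := mul_nonneg h8 (by linarith : 0 ≤ 3 - ∑ k ∈ Des b, x k)
    rw [hX] at h9
    linarith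
  rw [load_eq_cap hheavyu.le] at hSu
  have hcap0 : (0 : ℝ) ≤ N.cap := Nat.cast_nonneg _
  rcases le_or_gt N.cap (N.jobsAnc J' r).card with hheavyr | hheavyr
  · -- all three slots are saturated
    have h4 := h.lp.demand_le_cap (J' := J') b
    have h5 := load_anti (N := N) (J' := J') (hlrle r hf.right_le)
    rw [load_eq_cap hheavyr] at h5 hSr
    have h6 := mul_le_mul_of_nonneg_left h3.le hcap0
    linarith
  rw [load_eq_card hheavyr.le] at hSr
  have hA : (N.jobsAbove J' b).card ≤ N.cap := by omega
  rw [loadAbove, min_eq_left hA]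
  have hAy := h.sum_sum_y_le (N.jobsAbove J' b) (Des b)
  have hcuc' : ((N.jobsBelow J' cu).card : ℝ) ≤ N.cap := by exact_mod_cast hcuc
  have hsum := hf.sum_jobsBelow (J' := J') h fun j => (N.size j : ℝ)
  rw [sum_size_eq_card hcus, sum_size_eq_card hcrs] at hsum
  rcases le_or_gt (N.jobsAnc J' lr).card N.cap with hheavyl | hheavyl
  · -- neither of the two right slots is saturated
    have hE : spanningJobs N J' b u r = ∅ := IsFork.spanningJobs_eq_empty h hirr h3 hr2.ge
      fun k hk => (Finset.card_le_card
        (N.jobsAnc_anti J' (hlrle k (hk.trans hf.right_le)))).trans hheavyl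
    have hcardl := IsFork.card_add_card_le (b := b) (u := u) (r := r) (i := lr)
      (P := N.jobsBelow J' cr) subset_rfl hf.le_right hf.disjoint_right_spanning
      (fun j hj => N.mem_jobsAnc.2 ⟨(mem_jobsBelow.1 hj).1, hlrle _ (mem_jobsBelow.1 hj).2⟩)
      (Or.inr (hlrle r hf.right_le)) ((hlrle r hf.right_le).trans hrb)
    have hcardl' : ((N.jobsBelow J' cr).card : ℝ) + (spanningJobs N J' b u r).card +
      (N.jobsAbove J' b).card ≤ (N.jobsAnc J' lr).card := by exact_mod_cast hcardl
    rw [load_eq_card hheavyl] at hSr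
    rw [hE] at hsum hcardl' hcardr'
    simp only [Finset.sum_empty, Finset.card_empty, Nat.cast_zero, add_zero] at hsum hcardl' hcardr'
    rw [demand, hsum]
    have h5 : (0 : ℝ) ≤ ((N.jobsBelow J' cr).filter fun j => r ≤ N.node j).card :=
      Nat.cast_nonneg _
    linarith
  · -- only the slot of the right leaf is saturated
    rw [load_eq_cap hheavyl.le] at hSr
    have hlow : ∀ j, lr ≤ N.node j → ¬ r ≤ N.node j → N.node j < r := by
      intro j h1 h2
      rcases N.anc_chain lr (N.node j) r h1 (hlrle r hf.right_le) with h4 | h4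
      · exact lt_of_le_of_ne h4 fun e => h2 e.ge
      · exact absurd h4 h2
    obtain ⟨j₀, hj₀, hj₀'⟩ := Finset.exists_mem_notMem_of_card_lt_card (hheavyr.trans hheavyl)
    have hj₀r : N.node j₀ < r := hlow j₀ (N.mem_jobsAnc.1 hj₀).2 fun hle =>
      hj₀' (N.mem_jobsAnc.2 ⟨(N.mem_jobsAnc.1 hj₀).1, hle⟩)
    have h4 := hf.card_left_add_card_spanning_le (J' := J') h h3 hcuc
      (fun j hj => IsFork.two_le_size_of_mem_spanning h hirr hheavyr.le hxr1 hj) hj₀r.le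
    have h4' : ((N.jobsBelow J' cu).card : ℝ) + (spanningJobs N J' b u r).card ≤ N.cap := by
      exact_mod_cast h4
    have h5 := IsFork.card_low_add_sum_le h hrb hf.topmost_right hr2'
      ((N.jobsBelow J' cr).filter fun j => ¬ r ≤ N.node j)
      (fun j hj => (mem_jobsBelow.1 (Finset.mem_filter.1 hj).1).1) fun j hj =>
        hlow j (hlrle _ (mem_jobsBelow.1 (Finset.mem_filter.1 hj).1).2) (Finset.mem_filter.1 hj).2
    have h6 := Finset.card_filter_add_card_filter_not (s := N.jobsBelow J' cr)
      (fun j => r ≤ N.node j)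
    have h6' : (((N.jobsBelow J' cr).filter fun j => r ≤ N.node j).card : ℝ) +
        ((N.jobsBelow J' cr).filter fun j => ¬ r ≤ N.node j).card =
        (N.jobsBelow J' cr).card := by exact_mod_cast h6
    have h7 : ∑ j ∈ spanningJobs N J' b u r, (N.size j : ℝ) ≤
        2 * (spanningJobs N J' b u r).card := by
      have : ∑ j ∈ spanningJobs N J' b u r, (N.size j : ℝ) ≤
          ∑ j ∈ spanningJobs N J' b u r, (2 : ℝ) := Finset.sum_le_sum fun j hj => by
        exact_mod_cast IsFork.size_le_two h h3 (mem_spanningJobs.1 hj).2.1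
      rwa [Finset.sum_const, nsmul_eq_mul, mul_comm] at this
    have h8 : ∑ j ∈ N.jobsAbove J' b, ∑ i ∈ Des b, y i j =
        ∑ j ∈ N.jobsAbove J' b, ∑ i ∈ Des u, y i j +
        ∑ j ∈ N.jobsAbove J' b, ∑ i ∈ Des r, y i j := by
      rw [← Finset.sum_add_distrib]
      exact Finset.sum_congr rfl fun j _ => hf.sum h fun k hk => h.lp.y_eq_zero_of_x hk j
    have h9 := h.sum_sum_y_le (N.jobsAbove J' b) (Des u)
    -- since `r` is not the leaf, one full unit lies strictly below it
    have h10 : x r + 1 ≤ ∑ k ∈ Des r, x k := by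
      obtain ⟨M, hM, -, hM1⟩ := h.exists_sum_strict hf.topmost_right
      rw [sum_Des_eq_add x r, hM]
      have : 1 ≤ M := hM1 fun hmin => by
        have hle := hmin (hlrle r hf.right_le)
        exact (((N.mem_jobsAnc.1 hj₀).2.trans_lt hj₀r).trans_le hle).false
      have : (1 : ℝ) ≤ M := by exact_mod_cast this
      linarith
    have h11 := mul_le_mul_of_nonneg_left h10
      (Nat.cast_nonneg (α := ℝ) (N.jobsAbove J' b).card)
    rw [demand, hsum, h8, hX]
    linarith

/-! ### Summation over the tree -/

open scoped Classical in
theorem sum_Des_eq_add_children (N : NestedInstance V J) (g : V → ℝ) (b : V) :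
    ∑ k ∈ Des b, g k = g b + ∑ c with c ⋖ b, ∑ k ∈ Des c, g k := by
  rw [sum_Des_eq_add, ← Finset.sum_biUnion]
  · congr 1
    refine Finset.sum_congr ?_ fun _ _ => rfl
    ext k
    simp only [Finset.mem_filter, Finset.mem_biUnion, mem_Des, Finset.mem_univ, true_and]
    constructor
    · rintro ⟨h1, h2⟩
      obtain ⟨c, h3, h4⟩ := exists_le_covBy_of_lt (lt_of_le_of_ne h1 h2)
      exact ⟨c, h4, h3⟩
    · rintro ⟨c, h1, h2⟩
      exact ⟨h2.trans h1.le, (h2.trans_lt h1.lt).ne⟩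
  · intro c hc c' hc' hne
    simp only [Finset.coe_filter, Finset.mem_univ, true_and, Set.mem_ofPred_eq] at hc hc'
    refine Finset.disjoint_left.2 fun k hk hk' => hne ?_
    rcases N.anc_chain k c c' (mem_Des.1 hk) (mem_Des.1 hk') with h | h
    · by_contra hn
      exact hc.2 (lt_of_le_of_ne h hn) hc'.lt
    · by_contra hn
      exact hc'.2 (lt_of_le_of_ne h (Ne.symm hn)) hc.lt

open scoped Classical in
/-- The demand of a subtree whose root carries no slots is covered by the demands
of its branches: a job at the root counts as a job from above for each of them. -/
theorem demand_le_sum_children (h : N.IsRounded x y xt) {b : V} (hb : x b = 0) :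
    N.demand y J' b ≤ ∑ c with c ⋖ b, N.demand y J' c := by
  have hfib : ∀ a, ∑ j ∈ N.jobsBelow J' a, (N.size j : ℝ) =
      ∑ k ∈ Des a, ∑ j ∈ J' with N.node j = k, (N.size j : ℝ) := by
    intro a
    rw [← Finset.sum_fiberwise_of_maps_to (s := N.jobsBelow J' a) (t := Des a) (g := N.node)
      fun j hj => mem_Des.2 (mem_jobsBelow.1 hj).2]
    refine Finset.sum_congr rfl fun k hk => Finset.sum_congr ?_ fun _ _ => rfl
    ext j
    simp only [Finset.mem_filter, mem_jobsBelow]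
    constructor
    · exact fun hj => ⟨hj.1.1, hj.2⟩
    · exact fun hj => ⟨⟨hj.1, hj.2 ▸ mem_Des.1 hk⟩, hj.2⟩
  have hyb : ∀ j, ∑ i ∈ Des b, y i j = ∑ c with c ⋖ b, ∑ i ∈ Des c, y i j := fun j => by
    rw [sum_Des_eq_add_children N (fun i => y i j), h.lp.y_eq_zero_of_x hb, zero_add]
  have h1 : ∑ j ∈ J' with N.node j = b, (N.size j : ℝ) ≤
      ∑ j ∈ J' with N.node j = b, ∑ i ∈ Des b, y i j :=
    Finset.sum_le_sum fun j hj => h.lp.size_le (Finset.mem_filter.1 hj).2.le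
  have h2 : ∑ j ∈ J' with N.node j = b, ∑ i ∈ Des b, y i j +
      ∑ j ∈ N.jobsAbove J' b, ∑ i ∈ Des b, y i j =
      ∑ c with c ⋖ b, ∑ j ∈ N.jobsAbove J' c, ∑ i ∈ Des c, y i j := by
    rw [← Finset.sum_union]
    · have : J'.filter (fun j => N.node j = b) ∪ N.jobsAbove J' b = N.jobsAnc J' b := by
        ext j
        simp only [Finset.mem_union, Finset.mem_filter, mem_jobsAbove, mem_jobsAnc,
          le_iff_eq_or_lt]
        constructor
        · rintro (h | h)
          · exact ⟨h.1, Or.inl h.2.symm⟩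
          · exact ⟨h.1, Or.inr h.2⟩
        · rintro ⟨h, h' | h'⟩
          · exact Or.inl ⟨h, h'.symm⟩
          · exact Or.inr ⟨h, h'⟩
      rw [this, Finset.sum_congr rfl fun j _ => hyb j, Finset.sum_comm]
      refine Finset.sum_congr rfl fun c hc => ?_
      rw [jobsAbove_eq_of_covBy (Finset.mem_filter.1 hc).2]
    · exact Finset.disjoint_left.2 fun j h3 h4 =>
        (mem_jobsAbove.1 h4).2.ne (Finset.mem_filter.1 h3).2.symm
  have h3 : ∑ c with c ⋖ b, N.demand y J' c =
      ∑ c with c ⋖ b, ∑ k ∈ Des c, ∑ j ∈ J' with N.node j = k, (N.size j : ℝ) +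
      ∑ c with c ⋖ b, ∑ j ∈ N.jobsAbove J' c, ∑ i ∈ Des c, y i j := by
    rw [← Finset.sum_add_distrib]
    exact Finset.sum_congr rfl fun c _ => by rw [demand, hfib]
  rw [h3, ← h2, demand, hfib, sum_Des_eq_add_children N]
  linarith

/-- The supply of every subtree exceeds its demand by the load above it times the net number of
units gained by the rounding, where each node that is rounded down is charged one unit. -/
theorem demand_add_le (h : N.IsRounded x y xt) (hirr : N.Irreducible xt J') (b : V) :
    N.demand y J' b + N.loadAbove J' b *
      (∑ i ∈ Des b, xt i - ∑ i ∈ Des b, x i - (loweredNodes x xt b).card) ≤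
      ∑ i ∈ Des b, N.load J' i * xt i := by
  classical
  induction b using (wellFounded_lt (α := V)).induction with
  | _ b ih =>
  rcases (loweredNodes x xt b).eq_empty_or_nonempty with hE | hne
  · exact h.demand_add_le_of_loweredNodes_eq_empty hE
  obtain ⟨u, hu⟩ := id hne
  obtain ⟨hub, hux⟩ := mem_loweredNodes.1 hu
  rcases lt_or_ge (∑ k ∈ Des b, x k) 2 with h2 | h2
  · exact h.demand_add_le_of_sum_lt_two hux hub h2
  rcases lt_or_ge (∑ k ∈ Des b, x k) 3 with h3 | h3
  · exact h.demand_add_le_of_fork hirr hux hub h2 h3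
  have hub' : u < b := by
    refine lt_of_le_of_ne hub fun e => ?_
    subst e
    linarith [(h.sum_of_lt hux).2]
  have hb0 : x b = 0 := (h.isTopmost_of_lt hux).2 b hub'
  have hbt0 : xt b = 0 := h.eq_zero hb0
  have hcard : ∀ a, ((loweredNodes x xt a).card : ℝ) =
      ∑ k ∈ Des a, if xt k < x k then (1 : ℝ) else 0 := fun a => by
    rw [loweredNodes, Finset.card_filter]
    push_cast
    rfl
  have hgain := h.card_loweredNodes_le h3 hne
  have hD := h.demand_le_sum_children (J' := J') hb0
  have hchild : ∀ c ∈ Finset.univ.filter (· ⋖ b), N.demand y J' c + N.load J' b *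
      (∑ i ∈ Des c, xt i - ∑ i ∈ Des c, x i - ∑ k ∈ Des c, if xt k < x k then (1 : ℝ) else 0) ≤
      ∑ i ∈ Des c, N.load J' i * xt i := fun c hc => by
    have hcb := (Finset.mem_filter.1 hc).2
    rw [← loadAbove_eq_of_covBy hcb, ← hcard]
    exact ih c hcb.lt
  have hsum := Finset.sum_le_sum hchild
  rw [Finset.sum_add_distrib, ← Finset.mul_sum, Finset.sum_sub_distrib,
    Finset.sum_sub_distrib] at hsum
  have e1 := sum_Des_eq_add_children N xt b
  have e2 := sum_Des_eq_add_children N x b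
  have e3 := sum_Des_eq_add_children N (fun k => if xt k < x k then (1 : ℝ) else 0) b
  have e4 := sum_Des_eq_add_children N (fun k => N.load J' k * xt k) b
  rw [← hcard] at e3
  simp only [hb0, hbt0, lt_irrefl, if_false, mul_zero, zero_add] at e1 e2 e3 e4
  rw [← e1, ← e2, ← e3, ← e4] at hsum
  have := mul_le_mul_of_nonneg_right (loadAbove_le_load (N := N) (J' := J') (le_refl b))
    (sub_nonneg.2 hgain)
  linarith

/-- The cut condition for irreducible job sets. -/
theorem sum_size_le_of_irreducible (h : N.IsRounded x y xt) (hirr : N.Irreducible xt J') :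
    ∑ j ∈ J', (N.size j : ℝ) ≤ ∑ i, N.load J' i * xt i := by
  classical
  have h1 := h.demand_add_le hirr N.root
  have hDes : Des N.root = Finset.univ := by
    ext k
    simp [mem_Des, N.le_root]
  have hA : N.jobsAbove J' N.root = ∅ := Finset.eq_empty_of_forall_notMem fun j hj =>
    (mem_jobsAbove.1 hj).2.not_ge (N.le_root _)
  have hB : N.jobsBelow J' N.root = J' := by
    ext j
    simp [mem_jobsBelow, N.le_root]
  rw [demand, loadAbove, hA, hB, hDes] at h1
  simpa using h1

/-- The cut condition for all job sets: a minimal violating set would be irreducible. -/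
theorem sum_size_le (h : N.IsRounded x y xt) (J' : Finset J) :
    ∑ j ∈ J', (N.size j : ℝ) ≤ ∑ i, N.load J' i * xt i := by
  classical
  induction J' using Finset.strongInduction with
  | _ J' ih =>
  by_cases hirr : N.Irreducible xt J'
  · exact h.sum_size_le_of_irreducible hirr
  unfold Irreducible at hirr
  push Not at hirr
  obtain ⟨j, hj, hle⟩ := hirr
  have h1 := ih (J'.erase j) (Finset.erase_ssubset hj)
  rw [← Finset.add_sum_erase _ _ hj]
  have h2 : ∑ i ∈ Des (N.node j) with (N.jobsAnc J' i).card ≤ N.cap, xt i =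
      ∑ i, if i ≤ N.node j ∧ (N.jobsAnc J' i).card ≤ N.cap then xt i else 0 := by
    rw [Finset.sum_ite, Finset.sum_const_zero, add_zero]
    refine Finset.sum_congr ?_ fun _ _ => rfl
    ext i
    simp [mem_Des]
  rw [h2] at hle
  refine (add_le_add hle h1).trans ?_
  rw [← Finset.sum_add_distrib]
  refine Finset.sum_le_sum fun i _ => ?_
  have hmono : N.load (J'.erase j) i ≤ N.load J' i := by
    unfold load
    refine Nat.cast_le.2 (min_le_min_right _ (Finset.card_le_card fun k hk => ?_))
    exact N.mem_jobsAnc.2 ⟨Finset.mem_of_mem_erase (N.mem_jobsAnc.1 hk).1, (N.mem_jobsAnc.1 hk).2⟩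
  split_ifs with hi
  · have hjmem : j ∈ N.jobsAnc J' i := N.mem_jobsAnc.2 ⟨hj, hi.1⟩
    have herase : N.jobsAnc (J'.erase j) i = (N.jobsAnc J' i).erase j := by
      ext k
      simp only [mem_jobsAnc, Finset.mem_erase]
      tauto
    have hc := Finset.card_erase_add_one hjmem
    rw [← herase] at hc
    rw [load_eq_card hi.2, load_eq_card (by omega), ← hc]
    push_cast
    linarith
  · rw [zero_add]
    exact mul_le_mul_of_nonneg_right hmono (h.nonneg i)

/-- By Hall's theorem the cut condition makes the rounded vector feasible. -/
theorem feasibleSlots (h : N.IsRounded x y xt) : N.FeasibleSlots xt := by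
  classical
  choose m hm hlen using h.exists_nat
  let O : Finset N.Slot := Finset.univ.filter fun s => s.2.1 < m s.1
  have hcount : ∀ i, (Finset.univ.filter fun t : Fin (N.len i) => t.1 < m i).card = m i := by
    intro i
    rw [Fin.card_filter_val_lt, min_eq_right (hlen i)]
  obtain ⟨σ, hσ, hcap⟩ := exists_assignment_of_cut
    (fun (j : J) (s : N.Slot) => s ∈ O ∧ s.1 ≤ N.node j) N.size N.cap fun J' => by
      have h1 := h.sum_size_le J'
      have h2 : ∑ s : N.Slot, min (J'.filter fun j => s ∈ O ∧ s.1 ≤ N.node j).card N.cap =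
          ∑ i, min (N.jobsAnc J' i).card N.cap * m i := by
        rw [Fintype.sum_sigma]
        refine Finset.sum_congr rfl fun i _ => ?_
        have : ∀ t : Fin (N.len i),
            min (J'.filter fun j => (⟨i, t⟩ : N.Slot) ∈ O ∧ i ≤ N.node j).card N.cap =
            if t.1 < m i then min (N.jobsAnc J' i).card N.cap else 0 := by
          intro t
          by_cases ht : t.1 < m i <;> simp [O, ht, jobsAnc]
        rw [Finset.sum_congr rfl fun t _ => this t, Finset.sum_ite, Finset.sum_const_zero,
          add_zero, Finset.sum_const, hcount, smul_eq_mul, mul_comm]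
      have h3 : ∑ i, N.load J' i * xt i =
          ((∑ i, min (N.jobsAnc J' i).card N.cap * m i : ℕ) : ℝ) := by
        push_cast
        refine Finset.sum_congr rfl fun i _ => ?_
        rw [load, hm]
        push_cast
        rfl
      rw [h3, ← h2] at h1
      have h4 : ∑ j ∈ J', N.size j ≤
          ∑ s : N.Slot, min (J'.filter fun j => s ∈ O ∧ s.1 ≤ N.node j).card N.cap := by
        exact_mod_cast h1
      convert h4
  refine ⟨O, fun i => ?_, σ, fun j _ => ⟨fun s hs => ((hσ j).2 s hs).1, (hσ j).1,
    fun s hs => ((hσ j).2 s hs).2⟩, fun s => ?_⟩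
  · rw [hm, ← hcount i]
    congr 1
    refine (Finset.card_bij (fun t _ => ⟨i, t⟩) ?_ ?_ ?_).symm
    · intro t ht
      simpa [O] using ht
    · intro t _ t' _ htt
      simpa using htt
    · rintro ⟨i', t⟩ hs
      simp only [O, Finset.mem_filter, Finset.mem_univ, true_and] at hs
      obtain ⟨hs, rfl⟩ := hs
      exact ⟨t, by simpa using hs, rfl⟩
  · convert hcap s

end IsRounded

end NestedInstance

theorem mainTheorem1 {V J : Type*} [Fintype V] [PartialOrder V] [Fintype J]
    (N : NestedInstance V J) (x : V → ℝ) (y : V → J → ℝ)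
    (hLP : N.LPFeasible x y)
    (hTransformed : ∀ i₁ i₂ : V, i₂ < i₁ → x i₂ < N.len i₂ → x i₁ = 0)
    (hLeaf : ∀ i : V, IsMin i → (∃ j, N.node j = i) ∨ 1 ≤ x i)
    (xt : V → ℝ) (hRound : IsRounding x xt) :
    (∀ J' : Finset J, N.Irreducible xt J' →
      (∑ j ∈ J', (N.size j : ℝ)) ≤
        ∑ i, ((min (N.jobsAnc J' i).card N.cap : ℕ) : ℝ) * xt i) ∧
    N.FeasibleSlots xt :=
  have h := hLP.isRounded hTransformed hLeaf hRound
  ⟨fun _ hJ' => h.sum_size_le_of_irreducible hJ', h.feasibleSlots⟩
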